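/- Let $\ell^2$ be the complex Hilbert space of square summable sequences $(x_0,x_1,\dots)$. For integers $n\ge -1$ let $P_n$ be the truncation $P_nx=(x_0,\dots,x_n,0,0,\dots)$ (so $P_{-1}=0$) and $\widetilde Q_n=I-P_n$. A bounded operator $A$ on $\ell^2$ is causal if $P_nAP_n=P_nA$ for all $n$; $\mathcal B_c$ is the algebra of causal operators and $\mathcal K$ the space of compact operators. A partial isometry is an operator that preserves the norm on the orthogonal complement of its kernel. A causal operator $U$ is inner if it is a partial isometry and $U^\star U$ commutes with every $\widetilde Q_n$; a causal operator $A$ is outer if its range projection commutes with every $\widetilde Q_n$ and $A\widetilde Q_n\ell^2$ is dense in $\widetilde Q_n\ell^2\cap A\ell^2$ for every $n$. Let $\|T\|_1=\operatorname{tr}(T^\star T)^{1/2}$ be the trace class norm, $\mathcal C_1$ the trace class, and $$S=\{T\in\mathcal C_1:\ (I-\widetilde Q_{n+1})\,T\,\widetilde Q_n=0\ \text{ for all } n\ge -1\}$$ (the strictly lower triangular trace class operators, i.e. the preannihilator of $\mathcal B_c$ under trace duality). Let $T_1,T_2,T_3\in\mathcal B_c$ with factorizations $T_2=T_{2i}T_{2o}$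 and $T_3=T_{3o}T_{3i}$, where $T_{2i},T_{3i}$ are inner and $T_{2o},T_{3o}$ are outer. Put $B=T_{2i}^\star T_1T_{3i}^\star$, $$\mu=\inf_{Q\in\mathcal B_c}\|B-Q\|,\qquad \mu_{oo}=\inf_{Q\in\mathcal K}\|B-Q\| .$$ **Theorem 2.** Assume (A1): $T_{2o}$ and $T_{3o}$ are invertible in $\mathcal B_c$; and (A2): $B$ is compact. Then there exist $Q_o\in\mathcal B_c$ and $T_o\in S$ with $\|T_o\|_1=1$ such that: i) the infimum defining $\mu$ and the dual supremum are both attained, and $$\mu=\|B-Q_o\|=|\operatorname{tr}(T_oB)|=\max_{T\in S,\ \|T\|_1\le 1}|\operatorname{tr}(TB)|=\max_{n\ge -1}\|(I-\widetilde Q_n)B\widetilde Q_n\| ;$$ ii) if $\mu>\mu_{oo}$, then $\dfrac{B-Q_o}{\|B-Q_o\|}$ is a partial isometry, and it is isometric on the range of $T_o$. Moreover the condition $\mu>\mu_{oo}$ is sharp in the following sense: there are data $T_1,T_2,T_3$ as above satisfying (A1), with $T_{2i}$ an isometry and $T_{3i}$ a co-isometry, for which $\mu>\mu_{oo}$ fails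 (while $\mu>0$), and an optimal $Q_o\in\mathcal B_c$, $\|B-Q_o\|=\mu$, such that $\dfrac{B-Q_o}{\|B-Q_o\|}$ is not a partial isometry. -/

import Mathlib

open scoped InnerProductSpace

noncomputable section

namespace LTV

/-- The complex Hilbert space `ℓ²` of square summable sequences `(x₀, x₁, x₂, …)`. -/
abbrev Ell2 : Type := lp (fun _ : ℕ => ℂ) 2

/-- Bounded linear operators on `ℓ²`; `*` is composition, `star` is the Hilbert space adjoint,
`‖·‖` is the operator norm. -/
abbrev Op : Type := Ell2 →L[ℂ] Ell2

/-- The standard basis vector `e_k`. -/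
def e (k : ℕ) : Ell2 := lp.single 2 k (1 : ℂ)

/-- The truncation operator `P n = ∑_{0 ≤ k ≤ n} e_k ⊗ e_k`, for an integer `n`;
`P n = 0` for `n ≤ -1`. -/
def P (n : ℤ) : Op := ∑ k ∈ Finset.range (n + 1).toNat, InnerProductSpace.rankOne ℂ (e k) (e k)

/-- The projection `Q̃ n = I - P n`, whose range is the closed span of `e_k`, `k ≥ n + 1`. -/
def Qt (n : ℤ) : Op := 1 - P n

/-- `P n x = (x₀, …, x_n, 0, 0, …)`. -/
theorem P_apply (n : ℤ) (x : Ell2) (k : ℕ) :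
    (P n x : ℕ → ℂ) k = if (k : ℤ) ≤ n then (x : ℕ → ℂ) k else 0 := by
  have hin : ∀ j : ℕ, ⟪e j, x⟫_ℂ = (x : ℕ → ℂ) j := by
    intro j
    rw [e, lp.inner_single_left]
    simp
  have h1 : P n x = ∑ j ∈ Finset.range (n + 1).toNat, (x : ℕ → ℂ) j • e j := by
    simp only [P, sum_apply, InnerProductSpace.rankOne_apply, hin]
  rw [h1, lp.coeFn_sum, Finset.sum_apply]
  have h2 : ∀ j : ℕ, ((((x : ℕ → ℂ) j • e j : Ell2)) : ℕ → ℂ) k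
      = if k = j then (x : ℕ → ℂ) j else 0 := by
    intro j
    rw [lp.coeFn_smul, Pi.smul_apply, e, lp.single_apply, Pi.single_apply]
    split_ifs <;> simp
  simp only [h2, Finset.sum_ite_eq, Finset.mem_range]
  congr 1
  apply propext
  omega

/-- The algebra `B_c(ℓ², ℓ²)` of causal bounded operators: `P_n A P_n = P_n A` for all `n`. -/
def Bc : Set Op := {A | ∀ n : ℤ, -1 ≤ n → P n * A * P n = P n * A}

/-- Invertibility inside `B_c(ℓ², ℓ²)`: the operator and its inverse are both causal. -/
def InvertibleInBc (A : Op) : Prop := A ∈ Bc ∧ ∃ A' ∈ Bc, A * A' = 1 ∧ A' * A = 1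

/-- A partial isometry preserves the norm on the orthogonal complement of its kernel. -/
def IsPartialIsometry (A : Op) : Prop :=
  ∀ u ∈ (LinearMap.ker (A : Ell2 →ₗ[ℂ] Ell2))ᗮ, ‖A u‖ = ‖u‖

/-- Inner operators of the nest algebra: causal partial isometries `U` such that `U⋆ U` commutes
with every `Q̃ n`. -/
def IsInner (U : Op) : Prop :=
  U ∈ Bc ∧ IsPartialIsometry U ∧ ∀ n : ℤ, -1 ≤ n → Commute (star U * U) (Qt n)

/-- Outer operators of the nest algebra: causal operators `A` whose range projection commutes with
every `Q̃ n` and for which `A Q̃_n ℓ²` is dense in `Q̃_n ℓ² ∩ A ℓ²` for every `n`. -/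
def IsOuter (A : Op) : Prop :=
  A ∈ Bc ∧
  (∀ n : ℤ, -1 ≤ n → Commute
    ((LinearMap.range (A : Ell2 →ₗ[ℂ] Ell2)).topologicalClosure.starProjection) (Qt n)) ∧
  (∀ n : ℤ, -1 ≤ n → Set.range (Qt n) ∩ Set.range A ⊆ closure (A '' Set.range (Qt n)))

/-- The data of the disturbance rejection problem `inf_Q ‖T₁ - T₂ Q T₃‖`: causal `T₁, T₂, T₃`, an
inner-outer factorization `T₂ = T₂ᵢ T₂ₒ` and an outer-inner factorization `T₃ = T₃ₒ T₃ᵢ`. -/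
structure IsFactorizedData (T₁ T₂ T₃ T₂ᵢ T₂ₒ T₃ₒ T₃ᵢ : Op) : Prop where
  causal₁ : T₁ ∈ Bc
  causal₂ : T₂ ∈ Bc
  causal₃ : T₃ ∈ Bc
  inner₂ : IsInner T₂ᵢ
  outer₂ : IsOuter T₂ₒ
  factor₂ : T₂ = T₂ᵢ * T₂ₒ
  inner₃ : IsInner T₃ᵢ
  outer₃ : IsOuter T₃ₒ
  factor₃ : T₃ = T₃ₒ * T₃ᵢ

/-- The operator `T₂ᵢ⋆ T₁ T₃ᵢ⋆`. -/
def modelOp (T₁ T₂ᵢ T₃ᵢ : Op) : Op := star T₂ᵢ * T₁ * star T₃ᵢ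

/-- `μ`: the distance `inf {‖B - Q‖ : Q ∈ B_c}` from an operator to the causal operators. -/
def mu (B : Op) : ℝ := ⨅ Q : Bc, ‖B - (Q : Op)‖

/-- `μ_oo`: the distance `inf {‖B - Q‖ : Q compact}` from an operator to the compact operators. -/
def muoo (B : Op) : ℝ := ⨅ Q : {Q : Op // IsCompactOperator Q}, ‖B - (Q : Op)‖

/-- The absolute value `|T| = (T⋆ T)^{1/2}` of a bounded operator on a complex Hilbert space. -/
def absOp {H : Type*} [NormedAddCommGroup H] [InnerProductSpace ℂ H] [CompleteSpace H]
    (T : H →L[ℂ] H) : H →L[ℂ] H := CFC.abs T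

/-- The trace `∑ₖ ⟨T e_k, e_k⟩` (used on trace class operators). -/
def trace (T : Op) : ℂ := ∑' k : ℕ, ⟪e k, T (e k)⟫_ℂ

/-- Trace class operators: `∑ₖ ⟨|T| e_k, e_k⟩ < ∞`, where `|T| = (T⋆ T)^{1/2}`. -/
def IsTraceClass (T : Op) : Prop := Summable fun k : ℕ => (⟪e k, absOp T (e k)⟫_ℂ).re

/-- The trace class norm `‖T‖₁ = tr (T⋆ T)^{1/2}`. -/
def traceNorm (T : Op) : ℝ := ∑' k : ℕ, (⟪e k, absOp T (e k)⟫_ℂ).re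

/-- The preannihilator `S` of `B_c`: trace class `T` with
`(I - P_{N⁻}) T P_N = 0` for every `N = Q̃_n ℓ²` of the nest, `N⁻ = Q̃_{n+1} ℓ²` being the
immediate predecessor of `N`. These are the strictly lower triangular trace class operators. -/
def S : Set Op := {T | IsTraceClass T ∧ ∀ n : ℤ, -1 ≤ n → (1 - Qt (n + 1)) * T * Qt n = 0}

/-- The normalized error `(B - Q) / ‖B - Q‖`. -/
def normalizedError (B Q : Op) : Op := ((‖B - Q‖⁻¹ : ℝ) : ℂ) • (B - Q)

end LTV

end

noncomputable section

namespace LTV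

section Abstract

variable {H K L : Type*} [NormedAddCommGroup H] [InnerProductSpace ℂ H] [CompleteSpace H]
  [NormedAddCommGroup K] [InnerProductSpace ℂ K] [CompleteSpace K]
  [NormedAddCommGroup L] [InnerProductSpace ℂ L] [CompleteSpace L]

/-- Douglas' factorization lemma: a map dominated by `e` factors through `e` by a contraction. -/
theorem exists_contraction_comp_eq {X F : Type*} [AddCommGroup X] [Module ℂ X]
    [NormedAddCommGroup F] [NormedSpace ℂ F] [CompleteSpace F]
    (f : X →ₗ[ℂ] F) (e : X →ₗ[ℂ] H) (h : ∀ x, ‖f x‖ ≤ ‖e x‖) :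
    ∃ U : H →L[ℂ] F, (∀ z, ‖U z‖ ≤ ‖z‖) ∧ ∀ x, U (e x) = f x := by
  set M := (LinearMap.range e).topologicalClosure with hM
  have hmem : ∀ x, e x ∈ M := fun x =>
    (LinearMap.range e).le_topologicalClosure (LinearMap.mem_range_self e x)
  let e' : X →ₗ[ℂ] M := e.codRestrict M hmem
  have hdense : DenseRange e' := by
    intro z
    rw [Metric.mem_closure_iff]
    intro ε hε
    have hz : (z : H) ∈ closure (LinearMap.range e : Set H) := z.2
    obtain ⟨_, ⟨x, rfl⟩, hb⟩ := Metric.mem_closure_iff.1 hz ε hε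
    exact ⟨e' x, ⟨x, rfl⟩, hb⟩
  have : CompleteSpace M := (Submodule.isClosed_topologicalClosure _).completeSpace_coe
  have hn : ∀ x, ‖f x‖ ≤ 1 * ‖e' x‖ := fun x => by simpa [e'] using h x
  refine ⟨(f.extendOfNorm e').comp M.orthogonalProjectionOnto, fun z => ?_, fun x => ?_⟩
  · have h1 := LinearMap.norm_extendOfNorm_apply_le hdense 1 hn (M.orthogonalProjectionOnto z)
    rw [one_mul] at h1
    exact h1.trans (M.norm_orthogonalProjectionOnto_apply_le z)
  · have h1 : M.orthogonalProjectionOnto (e x) = e' x :=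
      Submodule.orthogonalProjectionOnto_mem_subspace_eq_self (e' x)
    rw [ContinuousLinearMap.comp_apply, h1]
    exact LinearMap.extendOfNorm_eq hdense ⟨1, hn⟩ x

/-- The square root of a positive operator represents its quadratic form. -/
theorem norm_sqrt_apply_sq {A : H →L[ℂ] H} (hA : 0 ≤ A) (x : H) :
    ‖CFC.sqrt A x‖ ^ 2 = (⟪x, A x⟫_ℂ).re := by
  have h1 : star (CFC.sqrt A) = CFC.sqrt A := (CFC.sqrt_nonneg A).isSelfAdjoint
  have h2 : CFC.sqrt A * CFC.sqrt A = A := CFC.sqrt_mul_sqrt_self A hA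
  have h3 : ‖CFC.sqrt A x‖ ^ 2 = (⟪CFC.sqrt A x, CFC.sqrt A x⟫_ℂ).re :=
    (inner_self_eq_norm_sq (𝕜 := ℂ) _).symm
  rw [h3, ← ContinuousLinearMap.adjoint_inner_right, ← ContinuousLinearMap.star_eq_adjoint, h1,
    ← mul_apply_eq_comp, h2]

theorem star_absOp (T : H →L[ℂ] H) : star (absOp T) = absOp T := (CFC.abs_nonneg T).isSelfAdjoint

theorem absOp_mul_self (T : H →L[ℂ] H) : absOp T * absOp T = star T * T := CFC.abs_mul_abs T

theorem absOp_eq_of_isPositive {A T : H →L[ℂ] H} (hA : A.IsPositive) (h : A * A = star T * T) :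
    absOp T = A :=
  CFC.sqrt_unique h ((ContinuousLinearMap.nonneg_iff_isPositive A).2 hA)

theorem norm_absOp_apply (T : H →L[ℂ] H) (x : H) : ‖absOp T x‖ = ‖T x‖ := by
  have h3 : ∀ A : H →L[ℂ] H, ‖A x‖ ^ 2 = (⟪x, (star A * A) x⟫_ℂ).re := fun A => by
    rw [mul_apply_eq_comp, ContinuousLinearMap.star_eq_adjoint,
      ContinuousLinearMap.adjoint_inner_right]
    exact (inner_self_eq_norm_sq (𝕜 := ℂ) _).symm
  refine (sq_eq_sq₀ (norm_nonneg _) (norm_nonneg _)).1 ?_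
  rw [h3, h3, star_absOp, absOp_mul_self]

theorem exists_sqrt_absOp (T : H →L[ℂ] H) : ∃ C : H →L[ℂ] H, star C = C ∧ C * C = absOp T ∧
    ∀ x, ‖C x‖ ^ 2 = (⟪x, absOp T x⟫_ℂ).re :=
  ⟨CFC.sqrt (absOp T), (CFC.sqrt_nonneg (absOp T)).isSelfAdjoint,
    CFC.sqrt_mul_sqrt_self _ (CFC.abs_nonneg T), norm_sqrt_apply_sq (CFC.abs_nonneg T)⟩

/-- Polar decomposition, with a contraction in place of the partial isometry. -/
theorem exists_eq_mul_absOp (T : H →L[ℂ] H) : ∃ U : H →L[ℂ] H, ‖U‖ ≤ 1 ∧ T = U * absOp T := by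
  obtain ⟨U, hU, hUT⟩ := exists_contraction_comp_eq (T : H →ₗ[ℂ] H)
    (absOp T : H →ₗ[ℂ] H) fun x => (norm_absOp_apply T x).ge
  refine ⟨U, ContinuousLinearMap.opNorm_le_bound _ zero_le_one fun x => ?_, ?_⟩
  · rw [one_mul]; exact hU x
  · ext1 x
    exact (hUT x).symm

/-- The defect operator of a contraction. -/
theorem exists_defect (F : H →L[ℂ] K) (hF : ∀ x, ‖F x‖ ≤ ‖x‖) :
    ∃ D : H →L[ℂ] H, ∀ x, ‖D x‖ ^ 2 = ‖x‖ ^ 2 - ‖F x‖ ^ 2 := by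
  have hform : ∀ x, ⟪x, (1 - ContinuousLinearMap.adjoint F ∘L F) x⟫_ℂ
      = ((‖x‖ ^ 2 - ‖F x‖ ^ 2 : ℝ) : ℂ) := by
    intro x
    simp [ContinuousLinearMap.adjoint_inner_right, inner_self_eq_norm_sq_to_K]
  have hpos : (0 : H →L[ℂ] H) ≤ 1 - ContinuousLinearMap.adjoint F ∘L F := by
    rw [ContinuousLinearMap.nonneg_iff_isPositive, ContinuousLinearMap.isPositive_iff_complex]
    intro x
    rw [← inner_conj_symm, hform]
    have := pow_le_pow_left₀ (norm_nonneg _) (hF x) 2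
    simp only [Complex.conj_ofReal, RCLike.re_to_complex, Complex.ofReal_re]
    exact ⟨trivial, by linarith⟩
  refine ⟨CFC.sqrt (1 - ContinuousLinearMap.adjoint F ∘L F), fun x => ?_⟩
  rw [norm_sqrt_apply_sq hpos, hform, Complex.ofReal_re]

/-- One-row case of Parrott's theorem: a row prescribed on a subspace can be completed so that the
enlarged column stays a contraction. -/
theorem exists_row_extension (F : H →L[ℂ] K) (hF : ∀ x, ‖F x‖ ≤ ‖x‖) (W : Submodule ℂ H)
    (t : H →L[ℂ] ℂ) (ht : ∀ y ∈ W, ‖F y‖ ^ 2 + ‖t y‖ ^ 2 ≤ ‖y‖ ^ 2) :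
    ∃ r : H →L[ℂ] ℂ, (∀ y ∈ W, r y = t y) ∧ ∀ x, ‖F x‖ ^ 2 + ‖r x‖ ^ 2 ≤ ‖x‖ ^ 2 := by
  obtain ⟨D, hD⟩ := exists_defect F hF
  obtain ⟨U, hU, hUe⟩ := exists_contraction_comp_eq
    ((t : H →ₗ[ℂ] ℂ).comp W.subtype) ((D : H →ₗ[ℂ] H).comp W.subtype) (by
      intro y
      have h1 := ht y y.2
      have h2 := hD (y : H)
      refine (sq_le_sq₀ (norm_nonneg _) (norm_nonneg _)).1 ?_
      simp only [LinearMap.comp_apply, Submodule.subtype_apply, ContinuousLinearMap.coe_coe]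
      linarith)
  refine ⟨U ∘L D, fun y hy => by simpa using hUe ⟨y, hy⟩, fun x => ?_⟩
  have h1 := pow_le_pow_left₀ (norm_nonneg _) (hU (D x)) 2
  rw [hD] at h1
  rw [ContinuousLinearMap.comp_apply]
  linarith

/-- A rank one modification of a contraction in the direction of a vector `v` orthogonal to the
range of the projection `Q` that makes it isometric at `v + y` with `y` small. -/
theorem exists_rankOne_isometric (G : H →L[ℂ] L) (hG : ∀ x, ‖G x‖ ≤ ‖x‖) (Q : H →L[ℂ] H)
    (hQ : star Q = Q) (hQQ : Q * Q = Q) {δ : ℝ} (hδ : δ ≤ 1 / 2) (hGQ : ‖G ∘L Q‖ ≤ δ)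
    (v : H) (hv : ‖v‖ = 1) (hQv : Q v = 0) (u : L) (hu : ‖u‖ = 1) :
    ∃ (s : ℝ) (y : H), Q y = y ∧ ‖y‖ ≤ 2 * δ ∧
      ‖G (v + y) + (s : ℂ) • u‖ = ‖v + y‖ ∧
      ∀ y', Q y' = y' → ‖G (v + y') + (s : ℂ) • u‖ ≤ ‖v + y'‖ := by
  set Γ : H →L[ℂ] L := G ∘L Q with hΓ
  set Γs : L →L[ℂ] H := ContinuousLinearMap.adjoint Γ with hΓs
  have hδ0 : 0 ≤ δ := (norm_nonneg _).trans hGQ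
  have hΓn : ∀ x, ‖Γ x‖ ≤ δ * ‖x‖ := fun x => Γ.le_of_opNorm_le hGQ x
  have hΓsn : ‖Γs‖ ≤ δ := by rw [hΓs, LinearIsometryEquiv.norm_map]; exact hGQ
  have hΓsn' : ∀ x, ‖Γs x‖ ≤ δ * ‖x‖ := fun x => Γs.le_of_opNorm_le hΓsn x
  have hlt : ‖Γs ∘L Γ‖ < 1 := by
    refine lt_of_le_of_lt (ContinuousLinearMap.opNorm_comp_le _ _) ?_
    nlinarith [norm_nonneg Γs, norm_nonneg Γ]
  obtain ⟨R, hR⟩ : ∃ R : H →L[ℂ] H, (1 - Γs ∘L Γ) * R = 1 :=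
    (isUnit_one_sub_of_norm_lt_one hlt).exists_right_inv
  have hQΓs : ∀ w, Q (Γs w) = Γs w := by
    intro w
    rw [hΓs, hΓ, ContinuousLinearMap.adjoint_comp, ← ContinuousLinearMap.star_eq_adjoint Q, hQ]
    exact congrArg (fun T : H →L[ℂ] H => T (ContinuousLinearMap.adjoint G w)) hQQ
  set a : ℝ → L := fun s => G v + (s : ℂ) • u with ha
  set y : ℝ → H := fun s => R (Γs (a s)) with hy
  have hyeq : ∀ s, y s = Γs (a s + Γ (y s)) := by
    intro s
    have h1 := congrArg (fun T : H →L[ℂ] H => T (Γs (a s))) hR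
    simp only [mul_apply_eq_comp, sub_apply, ContinuousLinearMap.comp_apply,
      one_apply_eq_self] at h1
    rw [map_add]
    exact sub_eq_iff_eq_add.1 h1
  have hQy : ∀ s, Q (y s) = y s := fun s => by rw [hyeq s, hQΓs]
  have hGy : ∀ z, Q z = z → G z = Γ z := fun z hz => by
    rw [hΓ, ContinuousLinearMap.comp_apply, hz]
  have hGv : ∀ (s : ℝ) (z : H), G (v + z) + (s : ℂ) • u = a s + G z := by
    intro s z
    simp only [map_add, ha]
    exact add_right_comm _ _ _
  have hvd : ∀ d, Q d = d → ⟪v, d⟫_ℂ = 0 := by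
    intro d hd
    rw [← hd, ← ContinuousLinearMap.adjoint_inner_left, ← ContinuousLinearMap.star_eq_adjoint, hQ,
      hQv, inner_zero_left]
  have hmin : ∀ (s : ℝ) (z : H), Q z = z →
      ‖v + y s‖ ^ 2 - ‖a s + G (y s)‖ ^ 2 ≤ ‖v + z‖ ^ 2 - ‖a s + G z‖ ^ 2 := by
    intro s z hz
    have hd : Q (z - y s) = z - y s := by rw [map_sub, hz, hQy]
    have e1 : v + z = (v + y s) + (z - y s) := by abel
    have e2 : a s + G z = (a s + G (y s)) + Γ (z - y s) := by
      rw [← hGy _ hd, map_sub]; abel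
    have h1 : ⟪v + y s, z - y s⟫_ℂ = ⟪y s, z - y s⟫_ℂ := by
      rw [inner_add_left, hvd _ hd, zero_add]
    have h2 : ⟪a s + G (y s), Γ (z - y s)⟫_ℂ = ⟪y s, z - y s⟫_ℂ := by
      rw [← ContinuousLinearMap.adjoint_inner_left, hGy _ (hQy s), ← hΓs, ← hyeq]
    have h3 := norm_add_sq (𝕜 := ℂ) (v + y s) (z - y s)
    have h4 := norm_add_sq (𝕜 := ℂ) (a s + G (y s)) (Γ (z - y s))
    rw [h1, ← e1] at h3
    rw [h2, ← e2] at h4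
    have h5 : ‖Γ (z - y s)‖ ≤ ‖z - y s‖ :=
      (hΓn _).trans (mul_le_of_le_one_left (norm_nonneg _) (by linarith))
    have h6 := pow_le_pow_left₀ (norm_nonneg _) h5 2
    linarith
  set g : ℝ → ℝ := fun s => ‖v + y s‖ ^ 2 - ‖a s + G (y s)‖ ^ 2 with hg
  have hacont : Continuous a := by
    rw [ha]
    fun_prop
  have hgcont : Continuous g := by
    have : Continuous y := by rw [hy]; fun_prop
    rw [hg]
    fun_prop
  have hg0 : 0 ≤ g 0 := by
    have h1 := hG (v + y 0)
    have h2 := hGv 0 (y 0)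
    rw [Complex.ofReal_zero, zero_smul, add_zero] at h2
    rw [h2] at h1
    have h3 := pow_le_pow_left₀ (norm_nonneg _) h1 2
    simp only [hg]
    linarith
  have hg2 : g 2 ≤ 0 := by
    have h1 := hmin 2 0 (map_zero Q)
    rw [add_zero, map_zero, add_zero, hv] at h1
    have h2 : ‖((2 : ℝ) : ℂ) • u‖ = 2 := by rw [norm_smul, hu]; simp
    have h3 : ‖((2 : ℝ) : ℂ) • u‖ ≤ ‖a 2‖ + ‖G v‖ := by
      have e : ((2 : ℝ) : ℂ) • u = a 2 - G v := by rw [ha]; simp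
      rw [e]
      exact norm_sub_le _ _
    have h4 := hG v
    simp only [hg]
    nlinarith [norm_nonneg (a 2)]
  obtain ⟨s, -, hs⟩ := intermediate_value_Icc' (zero_le_two (α := ℝ)) hgcont.continuousOn
    (Set.mem_Icc.2 ⟨hg2, hg0⟩)
  have heq : ‖a s + G (y s)‖ = ‖v + y s‖ := by
    have h1 : ‖a s + G (y s)‖ ^ 2 = ‖v + y s‖ ^ 2 := by
      simp only [hg] at hs
      linarith
    exact (sq_eq_sq₀ (norm_nonneg _) (norm_nonneg _)).1 h1
  refine ⟨s, y s, hQy s, ?_, by rw [hGv, heq], fun z hz => ?_⟩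
  · have h1 := hΓsn' (a s + Γ (y s))
    rw [← hyeq, ← hGy _ (hQy s), heq] at h1
    have h2 := norm_add_le v (y s)
    rw [hv] at h2
    nlinarith [norm_nonneg (y s)]
  · have h1 := hmin s z hz
    rw [hGv]
    refine (sq_le_sq₀ (norm_nonneg _) (norm_nonneg _)).1 ?_
    simp only [hg] at hs
    linarith

/-- Completion of a prescribed row such that the enlarged column is isometric at a small
perturbation of a vector `v` orthogonal to the subspace on which the row is prescribed. -/
theorem exists_row_extension_isometric (F : H →L[ℂ] K) (hF : ∀ x, ‖F x‖ ≤ ‖x‖) (Q : H →L[ℂ] H)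
    (hQ : star Q = Q) (hQQ : Q * Q = Q) (t : H →L[ℂ] ℂ) {δ : ℝ} (hδ0 : 0 ≤ δ) (hδ : δ ≤ 1 / 2)
    (ht : ∀ x, ‖F (Q x)‖ ^ 2 + ‖t (Q x)‖ ^ 2 ≤ (δ * ‖x‖) ^ 2)
    (v : H) (hv : ‖v‖ = 1) (hQv : Q v = 0) :
    ∃ r : H →L[ℂ] ℂ, (∀ x, r (Q x) = t (Q x)) ∧ (∀ x, ‖F x‖ ^ 2 + ‖r x‖ ^ 2 ≤ ‖x‖ ^ 2) ∧
      ∃ y, ‖y‖ ≤ 2 * δ ∧ ‖F (v + y)‖ ^ 2 + ‖r (v + y)‖ ^ 2 = ‖v + y‖ ^ 2 := by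
  have hidem : ∀ x, Q (Q x) = Q x := fun x => congrArg (fun T : H →L[ℂ] H => T x) hQQ
  obtain ⟨r₀, hr₀t, hr₀⟩ := exists_row_extension F hF (LinearMap.range (Q : H →ₗ[ℂ] H)) t (by
    rintro _ ⟨x, rfl⟩
    have h1 := ht (Q x)
    rw [hidem, mul_pow] at h1
    refine h1.trans (mul_le_of_le_one_left (sq_nonneg _) ?_)
    nlinarith)
  have hr₀Q : ∀ x, r₀ (Q x) = t (Q x) := fun x => hr₀t _ ⟨x, rfl⟩
  let G : H →L[ℂ] WithLp 2 (K × ℂ) :=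
    (WithLp.prodContinuousLinearEquiv 2 ℂ K ℂ).symm.toContinuousLinearMap ∘L (F.prod r₀)
  have hGapp : ∀ x, G x = WithLp.toLp 2 (F x, r₀ x) := fun x => rfl
  have hGn : ∀ x, ‖G x‖ ^ 2 = ‖F x‖ ^ 2 + ‖r₀ x‖ ^ 2 := fun x => by
    rw [hGapp, WithLp.prod_norm_sq_eq_of_L2]
    rfl
  let u : WithLp 2 (K × ℂ) := WithLp.toLp 2 (0, 1)
  have hu : ‖u‖ = 1 := by
    have : ‖u‖ ^ 2 = 1 := by rw [WithLp.prod_norm_sq_eq_of_L2]; simp [u]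
    exact (sq_eq_sq₀ (norm_nonneg _) zero_le_one).1 (by rw [this, one_pow])
  have hGs : ∀ (x : H) (s : ℝ), ‖G x + (s : ℂ) • u‖ ^ 2 = ‖F x‖ ^ 2 + ‖r₀ x + s‖ ^ 2 := by
    intro x s
    rw [hGapp, WithLp.prod_norm_sq_eq_of_L2]
    simp [u]
  obtain ⟨s, y, hQy, hyn, heq, hle⟩ := exists_rankOne_isometric G
    (fun x => (sq_le_sq₀ (norm_nonneg _) (norm_nonneg _)).1 (by rw [hGn]; exact hr₀ x)) Q hQ hQQ hδ
    (ContinuousLinearMap.opNorm_le_bound _ hδ0 fun x => by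
      refine (sq_le_sq₀ (norm_nonneg _) (by positivity)).1 ?_
      rw [ContinuousLinearMap.comp_apply, hGn, hr₀Q]
      exact ht x) v hv hQv u hu
  have hvQ : ∀ x, ⟪v, Q x⟫_ℂ = 0 := by
    intro x
    rw [← ContinuousLinearMap.adjoint_inner_left, ← ContinuousLinearMap.star_eq_adjoint, hQ, hQv,
      inner_zero_left]
  have hvv : ⟪v, v⟫_ℂ = 1 := by rw [inner_self_eq_norm_sq_to_K, hv]; simp
  let t' : H →L[ℂ] ℂ := r₀ + (s : ℂ) • innerSL ℂ v
  have ht' : ∀ x, t' x = r₀ x + s * ⟪v, x⟫_ℂ := fun x => by simp [t']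
  have ht'v : ∀ y, Q y = y → t' (v + y) = r₀ (v + y) + s := by
    intro y hy
    rw [ht', inner_add_right, hvv, ← hy, hvQ, add_zero, mul_one]
  have ht'Q : ∀ x, t' (Q x) = t (Q x) := fun x => by rw [ht', hvQ, mul_zero, add_zero, hr₀Q]
  set W : Submodule ℂ H := LinearMap.range (Q : H →ₗ[ℂ] H) ⊔ ℂ ∙ v with hW
  obtain ⟨r, hrt, hr⟩ := exists_row_extension F hF W t' (by
    intro z hz
    obtain ⟨_, ⟨x, rfl⟩, w, hw, rfl⟩ := Submodule.mem_sup.1 hz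
    obtain ⟨c, rfl⟩ := Submodule.mem_span_singleton.1 hw
    rw [ContinuousLinearMap.coe_coe]
    rcases eq_or_ne c 0 with rfl | hc
    · rw [zero_smul, add_zero, ht'Q, ← hr₀Q]
      exact hr₀ _
    · obtain ⟨z, hz, e⟩ : ∃ z, Q z = z ∧ Q x + c • v = c • (v + z) :=
        ⟨Q (c⁻¹ • x), hidem _, by rw [map_smul, smul_add, smul_inv_smul₀ hc, add_comm]⟩
      rw [e, map_smul, map_smul, norm_smul, norm_smul, norm_smul, mul_pow, mul_pow, mul_pow,
        ← mul_add, ht'v _ hz, ← hGs]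
      gcongr
      exact hle _ hz)
  have hvW : ∀ y, Q y = y → v + y ∈ W := fun y hy =>
    add_comm y v ▸ Submodule.add_mem_sup ⟨y, hy⟩ (Submodule.mem_span_singleton_self v)
  refine ⟨r, fun x => ?_, hr, y, hyn, ?_⟩
  · rw [hrt (Q x) (Submodule.mem_sup_left ⟨x, rfl⟩), ht'Q]
  · rw [hrt _ (hvW y hQy), ht'v y hQy, ← hGs, heq]

end Abstract

open Filter Topology InnerProductSpace

theorem inner_e_left (j : ℕ) (x : Ell2) : ⟪e j, x⟫_ℂ = (x : ℕ → ℂ) j := by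
  rw [e, lp.inner_single_left]
  simp

theorem e_apply (j k : ℕ) : (e j : ℕ → ℂ) k = if k = j then 1 else 0 := by
  rw [e, lp.single_apply, Pi.single_apply]

theorem norm_e (j : ℕ) : ‖e j‖ = 1 := by
  rw [e, lp.norm_single (by norm_num), norm_one]

theorem ell2_ext {x y : Ell2} (h : ∀ k, (x : ℕ → ℂ) k = (y : ℕ → ℂ) k) : x = y :=
  lp.ext (funext h)

theorem coord_add (x y : Ell2) (k : ℕ) :
    ((x + y : Ell2) : ℕ → ℂ) k = (x : ℕ → ℂ) k + (y : ℕ → ℂ) k := by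
  rw [lp.coeFn_add, Pi.add_apply]

theorem coord_sub (x y : Ell2) (k : ℕ) :
    ((x - y : Ell2) : ℕ → ℂ) k = (x : ℕ → ℂ) k - (y : ℕ → ℂ) k := by
  rw [lp.coeFn_sub, Pi.sub_apply]

theorem coord_smul (c : ℂ) (x : Ell2) (k : ℕ) :
    ((c • x : Ell2) : ℕ → ℂ) k = c * (x : ℕ → ℂ) k := by
  rw [lp.coeFn_smul, Pi.smul_apply, smul_eq_mul]

theorem Qt_apply (n : ℤ) (x : Ell2) (k : ℕ) :
    (Qt n x : ℕ → ℂ) k = if (k : ℤ) ≤ n then 0 else (x : ℕ → ℂ) k := by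
  rw [Qt, sub_apply, one_apply_eq_self, coord_sub, P_apply]
  split_ifs <;> simp

theorem one_sub_Qt (n : ℤ) : 1 - Qt n = P n := by rw [Qt, sub_sub_cancel]

theorem star_P (n : ℤ) : star (P n) = P n := by
  rw [ContinuousLinearMap.star_eq_adjoint]
  refine (ContinuousLinearMap.eq_adjoint_iff (P n) (P n)).2 (fun x y => ?_) |>.symm
  rw [lp.inner_eq_tsum, lp.inner_eq_tsum]
  refine tsum_congr fun k => ?_
  rw [P_apply, P_apply]
  split_ifs <;> simp

theorem star_Qt (n : ℤ) : star (Qt n) = Qt n := by rw [Qt, star_sub, star_one, star_P]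

theorem P_apply_P (m n : ℤ) (x : Ell2) : P m (P n x) = P (min m n) x := by
  refine ell2_ext fun k => ?_
  simp only [P_apply, le_min_iff, ite_and]

theorem Qt_apply_Qt (m n : ℤ) (x : Ell2) : Qt m (Qt n x) = Qt (max m n) x := by
  refine ell2_ext fun k => ?_
  simp only [Qt_apply]
  split_ifs <;> first | rfl | omega

theorem Qt_mul_self (n : ℤ) : Qt n * Qt n = Qt n := by
  ext1 x
  rw [mul_apply_eq_comp, Qt_apply_Qt, max_self]

theorem norm_apply_le_of_isProjection {Q : Op} (h : star Q = Q) (h' : Q * Q = Q) (x : Ell2) :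
    ‖Q x‖ ≤ ‖x‖ := by
  have h1 : ‖Q x‖ ^ 2 = (⟪x, Q x⟫_ℂ).re := by
    rw [← inner_self_eq_norm_sq (𝕜 := ℂ), ← ContinuousLinearMap.adjoint_inner_right,
      ← ContinuousLinearMap.star_eq_adjoint, h, ← mul_apply_eq_comp, h']
    rfl
  have h2 := (Complex.re_le_norm _).trans (norm_inner_le_norm (𝕜 := ℂ) x (Q x))
  rw [← h1] at h2
  rcases (norm_nonneg (Q x)).eq_or_lt with h0 | h0
  · rw [← h0]; exact norm_nonneg x
  · nlinarith

theorem norm_P_apply_le (n : ℤ) (x : Ell2) : ‖P n x‖ ≤ ‖x‖ :=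
  norm_apply_le_of_isProjection (star_P n)
    (by ext1 x; rw [mul_apply_eq_comp, P_apply_P, min_self]) x

theorem norm_Qt_apply_le (n : ℤ) (x : Ell2) : ‖Qt n x‖ ≤ ‖x‖ :=
  norm_apply_le_of_isProjection (star_Qt n) (Qt_mul_self n) x

theorem norm_P_le (n : ℤ) : ‖P n‖ ≤ 1 :=
  ContinuousLinearMap.opNorm_le_bound _ zero_le_one fun x => by
    rw [one_mul]; exact norm_P_apply_le n x

theorem norm_Qt_le (n : ℤ) : ‖Qt n‖ ≤ 1 :=
  ContinuousLinearMap.opNorm_le_bound _ zero_le_one fun x => by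
    rw [one_mul]; exact norm_Qt_apply_le n x

theorem norm_P_mul_mul_Qt_le (n : ℤ) (A : Op) : ‖P n * A * Qt n‖ ≤ ‖A‖ := by
  have h1 := norm_mul_le (P n * A) (Qt n)
  have h2 := norm_mul_le (P n) A
  nlinarith [norm_P_le n, norm_Qt_le n, norm_nonneg A, norm_nonneg (P n * A), norm_nonneg (Qt n)]

theorem norm_add_smul_e_sq (x : Ell2) (j : ℕ) (hx : (x : ℕ → ℂ) j = 0) (c : ℂ) :
    ‖x + c • e j‖ ^ 2 = ‖x‖ ^ 2 + ‖c‖ ^ 2 := by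
  have h : ⟪x, c • e j⟫_ℂ = 0 := by
    rw [inner_smul_right, ← inner_conj_symm, inner_e_left, hx, map_zero, mul_zero]
  rw [norm_add_sq (𝕜 := ℂ), h, norm_smul, norm_e]
  simp

theorem norm_P_sq_succ (j : ℕ) (x : Ell2) :
    ‖P j x‖ ^ 2 = ‖P ((j : ℤ) - 1) x‖ ^ 2 + ‖(x : ℕ → ℂ) j‖ ^ 2 := by
  rw [← norm_add_smul_e_sq (P ((j : ℤ) - 1) x) j (by rw [P_apply, if_neg (by omega)])]
  congr 2
  refine ell2_ext fun k => ?_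
  rw [coord_add, coord_smul, P_apply, P_apply, e_apply]
  rcases lt_trichotomy k j with h | h | h
  · rw [if_pos (by omega), if_pos (by omega), if_neg (by omega)]; simp
  · subst h; simp
  · rw [if_neg (by omega), if_neg (by omega), if_neg (by omega)]; simp

theorem mem_Bc_iff {A : Op} :
    A ∈ Bc ↔ ∀ (i : ℕ) (x : Ell2), (A (Qt i x) : ℕ → ℂ) i = 0 := by
  constructor
  · intro h i x
    have h1 := congrArg (fun T : Op => (T (Qt i x) : ℕ → ℂ) i) (h i (by omega))
    simp only [mul_apply_eq_comp] at h1
    rw [P_apply, P_apply, if_pos le_rfl, if_pos le_rfl] at h1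
    rw [← h1]
    have : P i (Qt i x) = 0 := ell2_ext fun k => by
      rw [P_apply, Qt_apply, lp.coeFn_zero]; split_ifs <;> rfl
    rw [this, map_zero, lp.coeFn_zero, Pi.zero_apply]
  · intro h n hn
    ext1 x
    refine ell2_ext fun i => ?_
    simp only [mul_apply_eq_comp]
    rw [P_apply, P_apply]
    split_ifs with hi
    · have h1 : x = P n x + Qt i (Qt n x) := by
        rw [Qt_apply_Qt, max_eq_right hi, Qt, sub_apply, one_apply_eq_self, add_sub_cancel]
      conv_rhs => rw [h1, map_add, coord_add, h, add_zero]
    · rfl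

theorem P_mul_mul_Qt_eq_zero {A : Op} (hA : A ∈ Bc) {n : ℤ} (hn : -1 ≤ n) :
    P n * A * Qt n = 0 := by
  rw [Qt, mul_sub, mul_one, hA n hn, sub_self]

theorem tendsto_P_apply (x : Ell2) : Tendsto (fun n : ℕ => P n x) atTop (𝓝 x) := by
  have h := (lp.hasSum_single (E := fun _ : ℕ => ℂ) (p := 2) (by norm_num) x).tendsto_sum_nat
  refine ((tendsto_add_atTop_iff_nat 1).2 h).congr fun n => ?_
  simp only [P, sum_apply, InnerProductSpace.rankOne_apply, inner_e_left]
  refine Finset.sum_congr (by congr 1) fun k _ => ?_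
  refine ell2_ext fun i => ?_
  rw [coord_smul, e_apply, lp.single_apply, Pi.single_apply]
  split_ifs with h
  · subst h; simp
  · simp

theorem tendsto_Qt_apply (x : Ell2) : Tendsto (fun n : ℕ => Qt n x) atTop (𝓝 0) := by
  have h := (tendsto_const_nhds (x := x)).sub (tendsto_P_apply x)
  rw [sub_self] at h
  exact h

/-- Compact operators are small on the tails of the nest. -/
theorem tendsto_norm_mul_Qt {B : Op} (hB : IsCompactOperator B) :
    Tendsto (fun n : ℕ => ‖B * Qt n‖) atTop (𝓝 0) := by
  have hx : ∀ n : ℕ, ∃ x : Ell2, ‖x‖ ≤ 1 ∧ ‖B * Qt n‖ ≤ ‖B (Qt n x)‖ + 1 / ((n : ℝ) + 1) := by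
    intro n
    by_contra! hcon
    have h0 : (0 : ℝ) < 1 / ((n : ℝ) + 1) := by positivity
    have h1 : ‖B * Qt n‖ ≤ ‖B * Qt n‖ - 1 / ((n : ℝ) + 1) := by
      refine ContinuousLinearMap.opNorm_le_of_unit_norm (𝕜 := ℂ) ?_ fun x hx => ?_
      · have := hcon 0 (by simp)
        simp only [map_zero, norm_zero] at this
        linarith
      · have := hcon x hx.le
        rw [mul_apply_eq_comp]
        linarith
    linarith
  choose x hx1 hx2 using hx
  obtain ⟨C, hC, hCB⟩ := hB.image_closedBall_subset_compact 1
  have hmem : ∀ n : ℕ, B (Qt n (x n)) ∈ C := fun n => hCB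
    ⟨_, mem_closedBall_zero_iff.2 ((norm_Qt_apply_le n (x n)).trans (hx1 n)), rfl⟩
  have hlim : Tendsto (fun n : ℕ => B (Qt n (x n))) atTop (𝓝 0) := by
    refine tendsto_of_subseq_tendsto fun ns hns => ?_
    obtain ⟨z, -, φ, hφ, hz⟩ := hC.tendsto_subseq fun k => hmem (ns k)
    refine ⟨φ, ?_⟩
    have hmono : Tendsto (fun k => ns (φ k)) atTop atTop := hns.comp hφ.tendsto_atTop
    have h1 : Tendsto (fun k => ⟪B (Qt (ns (φ k)) (x (ns (φ k)))), z⟫_ℂ) atTop (𝓝 ⟪z, z⟫_ℂ) :=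
      hz.inner tendsto_const_nhds
    have h2 : Tendsto (fun k => ⟪B (Qt (ns (φ k)) (x (ns (φ k)))), z⟫_ℂ) atTop (𝓝 0) := by
      have h3 := ((tendsto_Qt_apply (ContinuousLinearMap.adjoint B z)).comp hmono).norm
      rw [norm_zero] at h3
      refine squeeze_zero_norm (fun k => ?_) h3
      rw [← ContinuousLinearMap.adjoint_inner_right, ← ContinuousLinearMap.adjoint_inner_right,
        ← ContinuousLinearMap.star_eq_adjoint (Qt _), star_Qt]
      refine (norm_inner_le_norm _ _).trans ?_
      exact mul_le_of_le_one_left (norm_nonneg _) (hx1 _)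
    have h3 : z = 0 := inner_self_eq_zero.1 (tendsto_nhds_unique h1 h2)
    rw [← h3]
    exact hz
  have h4 := hlim.norm.add (tendsto_one_div_add_atTop_nhds_zero_nat (𝕜 := ℝ))
  rw [norm_zero, add_zero] at h4
  exact squeeze_zero (fun n => norm_nonneg _) hx2 h4

theorem tendsto_norm_P_mul_mul_Qt {B : Op} (hB : IsCompactOperator B) :
    Tendsto (fun n : ℕ => ‖P n * B * Qt n‖) atTop (𝓝 0) := by
  refine squeeze_zero (fun n => norm_nonneg _) (fun n => ?_) (tendsto_norm_mul_Qt hB)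
  rw [mul_assoc]
  refine (norm_mul_le _ _).trans ?_
  exact mul_le_of_le_one_left (norm_nonneg _) (norm_P_le n)

/-- `F` consists of the first `j` rows of a contraction that agrees with `B` above the
diagonal. -/
structure IsRowCompletion (B : Op) (j : ℕ) (F : Op) : Prop where
  contraction : ∀ x, ‖F x‖ ≤ ‖x‖
  rows : ∀ x, P ((j : ℤ) - 1) (F x) = F x
  agree : ∀ i : ℕ, i < j → ∀ x, (F (Qt i x) : ℕ → ℂ) i = (B (Qt i x) : ℕ → ℂ) i

theorem IsRowCompletion.apply_Qt {B F : Op} {j : ℕ} (hF : IsRowCompletion B j F) (x : Ell2) :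
    F (Qt j x) = P ((j : ℤ) - 1) (B (Qt j x)) := by
  refine ell2_ext fun i => ?_
  rw [← hF.rows, P_apply, P_apply]
  split_ifs with h
  · have h1 := hF.agree i (by omega) (Qt j x)
    rwa [Qt_apply_Qt, max_eq_right (by omega)] at h1
  · rfl

theorem IsRowCompletion.norm_sq_add {B F : Op} {j : ℕ} (hF : IsRowCompletion B j F) (x : Ell2) :
    ‖F (Qt j x)‖ ^ 2 + ‖((innerSL ℂ (e j)).comp B) (Qt j x)‖ ^ 2
      = ‖(P j * B * Qt j) x‖ ^ 2 := by
  rw [hF.apply_Qt, ContinuousLinearMap.comp_apply, innerSL_apply_apply, inner_e_left,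
    ← norm_P_sq_succ]
  rfl

theorem IsRowCompletion.coord_eq_zero {B F : Op} {j : ℕ} (hF : IsRowCompletion B j F)
    (x : Ell2) : (F x : ℕ → ℂ) j = 0 := by
  rw [← hF.rows, P_apply, if_neg (by omega)]

theorem IsRowCompletion.succ {B F : Op} {j : ℕ} (hF : IsRowCompletion B j F) (r : Ell2 →L[ℂ] ℂ)
    (hr : ∀ x, r (Qt j x) = (B (Qt j x) : ℕ → ℂ) j)
    (hr' : ∀ x, ‖F x‖ ^ 2 + ‖r x‖ ^ 2 ≤ ‖x‖ ^ 2) :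
    IsRowCompletion B (j + 1) (F + r.smulRight (e j)) where
  contraction x := by
    refine (sq_le_sq₀ (norm_nonneg _) (norm_nonneg _)).1 ?_
    rw [add_apply, ContinuousLinearMap.smulRight_apply,
      norm_add_smul_e_sq _ _ (hF.coord_eq_zero x)]
    exact hr' x
  rows x := by
    refine ell2_ext fun k => ?_
    rw [P_apply]
    split_ifs with h
    · rfl
    · rw [add_apply, ContinuousLinearMap.smulRight_apply, coord_add, coord_smul, e_apply,
        if_neg (by omega), mul_zero, add_zero, ← hF.rows, P_apply, if_neg (by omega)]
  agree i hi x := by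
    rw [add_apply, ContinuousLinearMap.smulRight_apply, coord_add, coord_smul, e_apply]
    rcases Nat.lt_succ_iff_lt_or_eq.1 hi with h | rfl
    · rw [if_neg h.ne, mul_zero, add_zero, hF.agree i h]
    · rw [if_pos rfl, mul_one, hF.coord_eq_zero, zero_add, hr]

/-- One more row can be chosen, and if `‖P_j B Q̃_j‖ ≤ 1/2` then any basis vector `e i`, `i ≤ j`,
can be made close to a vector at which the completion is isometric. -/
theorem IsRowCompletion.exists_row {B F : Op} {j : ℕ} (hB : ‖P j * B * Qt j‖ ≤ 1)
    (hF : IsRowCompletion B j F) {i : ℕ} (hi : i ≤ j) :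
    ∃ r : Ell2 →L[ℂ] ℂ, (∀ x, r (Qt j x) = (B (Qt j x) : ℕ → ℂ) j) ∧
      (∀ x, ‖F x‖ ^ 2 + ‖r x‖ ^ 2 ≤ ‖x‖ ^ 2) ∧
      (‖P j * B * Qt j‖ ≤ 1 / 2 → ∃ y, ‖y‖ ≤ 2 * ‖P j * B * Qt j‖ ∧
        ‖F (e i + y)‖ ^ 2 + ‖r (e i + y)‖ ^ 2 = ‖e i + y‖ ^ 2) := by
  have hbound : ∀ x, ‖F (Qt j x)‖ ^ 2 + ‖((innerSL ℂ (e j)).comp B) (Qt j x)‖ ^ 2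
      ≤ (‖P j * B * Qt j‖ * ‖x‖) ^ 2 := fun x => by
    rw [hF.norm_sq_add]
    exact pow_le_pow_left₀ (norm_nonneg _) (ContinuousLinearMap.le_opNorm _ _) 2
  have hcoord : ∀ x, ((innerSL ℂ (e j)).comp B) x = (B x : ℕ → ℂ) j := fun x => inner_e_left _ _
  by_cases hhalf : ‖P j * B * Qt j‖ ≤ 1 / 2
  · obtain ⟨r, hr, hr', hy⟩ := exists_row_extension_isometric F hF.contraction (Qt j) (star_Qt j)
      (Qt_mul_self j) ((innerSL ℂ (e j)).comp B) (norm_nonneg _) hhalf hbound (e i) (norm_e i)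
      (ell2_ext fun k => by
        rw [Qt_apply, e_apply, lp.coeFn_zero, Pi.zero_apply]
        split_ifs <;> first | rfl | omega)
    exact ⟨r, fun x => (hr x).trans (hcoord _), hr', fun _ => hy⟩
  · obtain ⟨r, hr, hr'⟩ := exists_row_extension F hF.contraction
      (LinearMap.range (Qt j : Ell2 →ₗ[ℂ] Ell2)) ((innerSL ℂ (e j)).comp B) (by
        rintro _ ⟨x, rfl⟩
        have h1 := hbound (Qt j x)
        rw [Qt_apply_Qt, max_self] at h1
        refine h1.trans (pow_le_pow_left₀ (by positivity) ?_ 2)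
        exact mul_le_of_le_one_left (norm_nonneg _) hB)
    exact ⟨r, fun x => (hr _ ⟨x, rfl⟩).trans (hcoord _), hr', fun h => absurd h hhalf⟩

/-- Bounded square sums of functionals assemble to an operator into `ℓ²`. -/
theorem exists_op_of_rows (r : ℕ → Ell2 →L[ℂ] ℂ)
    (hr : ∀ (n : ℕ) (x : Ell2), ∑ i ∈ Finset.range n, ‖r i x‖ ^ 2 ≤ ‖x‖ ^ 2) :
    ∃ E : Op, (∀ x i, (E x : ℕ → ℂ) i = r i x) ∧ ∀ x, ‖E x‖ ≤ ‖x‖ := by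
  have hs : ∀ (x : Ell2) (s : Finset ℕ), ∑ i ∈ s, ‖r i x‖ ^ (2 : ENNReal).toReal
      ≤ ‖x‖ ^ (2 : ENNReal).toReal := by
    intro x s
    simp only [ENNReal.toReal_ofNat, Real.rpow_ofNat]
    refine le_trans ?_ (hr (s.sup id + 1) x)
    refine Finset.sum_le_sum_of_subset_of_nonneg (fun i hi => ?_) fun _ _ _ => sq_nonneg _
    exact Finset.mem_range.2 (Nat.lt_succ_of_le (Finset.le_sup (f := id) hi))
  let E₀ : Ell2 →ₗ[ℂ] Ell2 :=
    { toFun := fun x => ⟨fun i => r i x, memℓp_gen' (hs x)⟩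
      map_add' := fun x y => ell2_ext fun i => map_add (r i) x y
      map_smul' := fun c x => ell2_ext fun i => map_smul (r i) c x }
  have hE₀ : ∀ x, ‖E₀ x‖ ≤ 1 * ‖x‖ := fun x => by
    rw [one_mul]
    exact lp.norm_le_of_forall_sum_le (by norm_num) (norm_nonneg _) (hs x)
  exact ⟨E₀.mkContinuous 1 hE₀, fun x i => rfl, fun x => (hE₀ x).trans_eq (one_mul _)⟩

theorem star_mul_self_eq_one_of_norm_e {E : Op} (hE : ∀ x, ‖E x‖ ≤ ‖x‖)
    (he : ∀ i, ‖E (e i)‖ = 1) : star E * E = 1 := by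
  have hbasis : ∀ i, (star E * E) (e i) = e i := by
    intro i
    have hn : ‖(star E * E) (e i)‖ ≤ 1 := by
      rw [mul_apply_eq_comp]
      have h1 : ‖star E‖ ≤ 1 := by
        rw [ContinuousLinearMap.star_eq_adjoint, LinearIsometryEquiv.norm_map]
        exact ContinuousLinearMap.opNorm_le_bound _ zero_le_one fun x => by
          rw [one_mul]; exact hE x
      have h2 := (star E).le_of_opNorm_le h1 (E (e i))
      rwa [he, one_mul] at h2
    have h3 : ⟪(star E * E) (e i), e i⟫_ℂ = 1 := by
      rw [mul_apply_eq_comp, ContinuousLinearMap.star_eq_adjoint,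
        ContinuousLinearMap.adjoint_inner_left, inner_self_eq_norm_sq_to_K, he]
      simp
    have h4 := norm_sub_sq (𝕜 := ℂ) ((star E * E) (e i)) (e i)
    rw [h3, norm_e] at h4
    rw [RCLike.one_re] at h4
    have h5 : ‖(star E * E) (e i) - e i‖ ^ 2 ≤ 0 := by
      nlinarith [norm_nonneg ((star E * E) (e i))]
    have h6 : ‖(star E * E) (e i) - e i‖ = 0 := by
      nlinarith [norm_nonneg ((star E * E) (e i) - e i)]
    exact sub_eq_zero.1 (norm_eq_zero.1 h6)
  have hstar : star (star E * E) = star E * E := by rw [star_mul, star_star]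
  ext1 x
  refine ell2_ext fun k => ?_
  rw [← inner_e_left, ← hstar, ContinuousLinearMap.star_eq_adjoint,
    ContinuousLinearMap.adjoint_inner_right, hbasis, inner_e_left, one_apply_eq_self]

/-- If the corners `P_n B Q̃_n` are contractions that tend to `0`, then `B` can be changed by a
causal operator into an isometry. -/
theorem exists_isometry_sub_mem_Bc {B : Op} (hB : ∀ n : ℕ, ‖P n * B * Qt n‖ ≤ 1)
    (hB0 : Tendsto (fun n : ℕ => ‖P n * B * Qt n‖) atTop (𝓝 0)) :
    ∃ E : Op, star E * E = 1 ∧ B - E ∈ Bc := by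
  have hstep : ∀ (j : ℕ) (F : {F : Op // IsRowCompletion B j F}),
      ∃ F' : {F : Op // IsRowCompletion B (j + 1) F}, ∃ r : Ell2 →L[ℂ] ℂ,
        (∀ x, r (Qt j x) = (B (Qt j x) : ℕ → ℂ) j) ∧
        (∀ x, ‖F'.1 x‖ ^ 2 = ‖F.1 x‖ ^ 2 + ‖r x‖ ^ 2) ∧
        (‖P j * B * Qt j‖ ≤ 1 / 2 → ∃ y, ‖y‖ ≤ 2 * ‖P j * B * Qt j‖ ∧
          ‖F'.1 (e j.unpair.1 + y)‖ = ‖e j.unpair.1 + y‖) := by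
    rintro j ⟨F, hF⟩
    obtain ⟨r, hr, hr', hy⟩ := hF.exists_row (hB j) j.unpair_left_le
    have hn : ∀ x, ‖(F + r.smulRight (e j)) x‖ ^ 2 = ‖F x‖ ^ 2 + ‖r x‖ ^ 2 := fun x => by
      rw [add_apply, ContinuousLinearMap.smulRight_apply,
        norm_add_smul_e_sq _ _ (hF.coord_eq_zero x)]
    refine ⟨⟨F + r.smulRight (e j), hF.succ r hr hr'⟩, r, hr, hn, fun h => ?_⟩
    obtain ⟨y, hy1, hy2⟩ := hy h
    exact ⟨y, hy1, (sq_eq_sq₀ (norm_nonneg _) (norm_nonneg _)).1 ((hn _).trans hy2)⟩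
  choose next r hr hn hy using hstep
  have hzero : IsRowCompletion B 0 0 :=
    ⟨fun x => by simp, fun x => by simp, fun i hi => absurd hi (Nat.not_lt_zero i)⟩
  let F : ∀ j : ℕ, {F : Op // IsRowCompletion B j F} := fun j =>
    Nat.rec ⟨0, hzero⟩ (fun j F => next j F) j
  have hsum : ∀ (n : ℕ) (x : Ell2),
      ∑ i ∈ Finset.range n, ‖r i (F i) x‖ ^ 2 = ‖(F n).1 x‖ ^ 2 := by
    intro n x
    induction n with
    | zero => simp [F]
    | succ n ih => rw [Finset.sum_range_succ, ih]; exact (hn n (F n) x).symm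
  obtain ⟨E, hEr, hE⟩ := exists_op_of_rows (fun i => r i (F i)) fun n x => by
    rw [hsum]
    exact pow_le_pow_left₀ (norm_nonneg _) ((F n).2.contraction x) 2
  have hFE : ∀ n x, ‖(F n).1 x‖ ≤ ‖E x‖ := by
    intro n x
    refine (sq_le_sq₀ (norm_nonneg _) (norm_nonneg _)).1 ?_
    rw [← hsum]
    have h := lp.sum_rpow_le_norm_rpow (p := 2) (by norm_num) (E x) (Finset.range n)
    simpa only [ENNReal.toReal_ofNat, Real.rpow_ofNat, hEr] using h
  refine ⟨E, star_mul_self_eq_one_of_norm_e hE fun i => ?_, ?_⟩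
  · have hpair : Tendsto (fun m : ℕ => Nat.pair i m) atTop atTop :=
      tendsto_atTop_mono (fun m => Nat.right_le_pair i m) tendsto_id
    have hlim := hB0.comp hpair
    have hex : ∀ᶠ m in atTop, ∃ y : Ell2,
        ‖y‖ ≤ 2 * ‖P (Nat.pair i m : ℕ) * B * Qt (Nat.pair i m : ℕ)‖ ∧
        ‖E (e i + y)‖ = ‖e i + y‖ := by
      filter_upwards [hlim.eventually (ge_mem_nhds (show (0 : ℝ) < 1 / 2 by norm_num))] with m hm
      obtain ⟨y, hy1, hy2⟩ := hy (Nat.pair i m) (F _) hm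
      rw [Nat.unpair_pair] at hy2
      exact ⟨y, hy1, le_antisymm (hE _) (hy2.symm.trans_le (hFE (Nat.pair i m + 1) _))⟩
    refine le_antisymm ((hE _).trans_eq (norm_e i)) ?_
    have hlim' := (hlim.const_mul 4).const_add ‖E (e i)‖
    rw [mul_zero, add_zero] at hlim'
    refine ge_of_tendsto hlim' ?_
    filter_upwards [hex] with m hm
    obtain ⟨y, hy1, hy2⟩ := hm
    have h1 : ‖e i‖ ≤ ‖e i + y‖ + ‖y‖ := by
      simpa using norm_sub_le (e i + y) y
    have h2 : ‖E (e i + y)‖ ≤ ‖E (e i)‖ + ‖E y‖ := by rw [map_add]; exact norm_add_le _ _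
    have h3 := hE y
    rw [norm_e] at h1
    simp only [Function.comp_apply]
    linarith
  · refine mem_Bc_iff.2 fun i x => ?_
    rw [sub_apply, coord_sub, hEr, hr, sub_self]

theorem hasSum_norm_coord_sq (x : Ell2) : HasSum (fun k => ‖(x : ℕ → ℂ) k‖ ^ 2) (‖x‖ ^ 2) := by
  simpa only [ENNReal.toReal_ofNat, Real.rpow_ofNat] using
    lp.hasSum_norm (p := 2) (by norm_num) x

theorem tsum_ofReal_norm_coord_sq (x : Ell2) :
    ∑' k, ENNReal.ofReal (‖(x : ℕ → ℂ) k‖ ^ 2) = ENNReal.ofReal (‖x‖ ^ 2) := by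
  rw [← (hasSum_norm_coord_sq x).tsum_eq,
    ENNReal.ofReal_tsum_of_nonneg (fun k => sq_nonneg _) (hasSum_norm_coord_sq x).summable]

/-- The Hilbert–Schmidt norm of an operator and of its adjoint agree. -/
theorem tsum_ofReal_norm_star_apply_e_sq (A : Op) :
    ∑' k, ENNReal.ofReal (‖star A (e k)‖ ^ 2) = ∑' k, ENNReal.ofReal (‖A (e k)‖ ^ 2) := by
  simp only [← tsum_ofReal_norm_coord_sq]
  rw [ENNReal.tsum_comm]
  refine tsum_congr fun j => tsum_congr fun k => ?_
  rw [← inner_e_left, ← inner_e_left, ContinuousLinearMap.star_eq_adjoint,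
    ContinuousLinearMap.adjoint_inner_right, norm_inner_symm]

theorem sum_norm_mul_apply_e_sq_le {C Y : Op} {τ : ℝ} (hC : HasSum (fun k => ‖C (e k)‖ ^ 2) τ)
    (s : Finset ℕ) : ∑ k ∈ s, ‖(C * Y) (e k)‖ ^ 2 ≤ ‖Y‖ ^ 2 * τ := by
  have hτ : 0 ≤ τ := hC.nonneg fun k => sq_nonneg _
  rw [← ENNReal.ofReal_le_ofReal_iff (by positivity),
    ENNReal.ofReal_sum_of_nonneg fun _ _ => sq_nonneg _]
  refine (ENNReal.sum_le_tsum s).trans ?_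
  have hstarC : ∑' k, ENNReal.ofReal (‖star C (e k)‖ ^ 2) = ENNReal.ofReal τ := by
    rw [tsum_ofReal_norm_star_apply_e_sq, ← hC.tsum_eq,
      ENNReal.ofReal_tsum_of_nonneg (fun _ => sq_nonneg _) hC.summable]
  rw [← tsum_ofReal_norm_star_apply_e_sq, ENNReal.ofReal_mul (sq_nonneg _), ← hstarC,
    ← ENNReal.tsum_mul_left]
  refine ENNReal.tsum_le_tsum fun k => ?_
  rw [← ENNReal.ofReal_mul (sq_nonneg _), ← mul_pow, star_mul, mul_apply_eq_comp]
  refine ENNReal.ofReal_le_ofReal (pow_le_pow_left₀ (norm_nonneg _) ?_ 2)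
  have h := (star Y).le_opNorm (star C (e k))
  rwa [ContinuousLinearMap.star_eq_adjoint Y, LinearIsometryEquiv.norm_map] at h

/-- `|tr (T X)| ≤ ‖T‖₁ ‖X‖`, for a partial sum of the trace. -/
theorem norm_sum_inner_le {T : Op} (hT : IsTraceClass T) (X : Op) (s : Finset ℕ) :
    ‖∑ k ∈ s, ⟪e k, (T * X) (e k)⟫_ℂ‖ ≤ ‖X‖ * traceNorm T := by
  obtain ⟨U, hU, hTU⟩ := exists_eq_mul_absOp T
  obtain ⟨C, hCs, hCC, hCn⟩ := exists_sqrt_absOp T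
  rw [ContinuousLinearMap.star_eq_adjoint] at hCs
  have hsum : HasSum (fun k => ‖C (e k)‖ ^ 2) (traceNorm T) := by
    simp only [hCn]
    exact hT.hasSum
  have hτ : 0 ≤ traceNorm T := hsum.nonneg fun k => sq_nonneg _
  have h1 := sum_norm_mul_apply_e_sq_le (Y := star U) hsum s
  have h2 := sum_norm_mul_apply_e_sq_le (Y := X) hsum s
  have hterm : ∀ k, ⟪e k, (T * X) (e k)⟫_ℂ = ⟪(C * star U) (e k), (C * X) (e k)⟫_ℂ := by
    intro k
    conv_lhs => rw [hTU, ← hCC]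
    simp only [mul_apply_eq_comp]
    rw [← ContinuousLinearMap.adjoint_inner_left, ← ContinuousLinearMap.adjoint_inner_left, hCs]
    rfl
  have h3 : ‖star U‖ ^ 2 * traceNorm T ≤ traceNorm T := by
    rw [ContinuousLinearMap.star_eq_adjoint, LinearIsometryEquiv.norm_map]
    exact mul_le_of_le_one_left hτ (pow_le_one₀ (norm_nonneg _) hU)
  have h4 : ‖∑ k ∈ s, ⟪e k, (T * X) (e k)⟫_ℂ‖
      ≤ ∑ k ∈ s, ‖(C * star U) (e k)‖ * ‖(C * X) (e k)‖ := by
    refine (norm_sum_le _ _).trans (Finset.sum_le_sum fun k _ => ?_)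
    rw [hterm]
    exact norm_inner_le_norm _ _
  have h5 := Finset.sum_mul_sq_le_sq_mul_sq s (fun k => ‖(C * star U) (e k)‖)
    (fun k => ‖(C * X) (e k)‖)
  refine h4.trans ((pow_le_pow_iff_left₀ (Finset.sum_nonneg fun _ _ => by positivity)
    (by positivity) two_ne_zero).1 ?_)
  calc _ ≤ _ := h5
    _ ≤ traceNorm T * (‖X‖ ^ 2 * traceNorm T) :=
      mul_le_mul (h1.trans h3) h2 (Finset.sum_nonneg fun _ _ => sq_nonneg _) hτ
    _ = _ := by ring

theorem norm_trace_mul_le {T : Op} (hT : IsTraceClass T) (X : Op) :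
    ‖trace (T * X)‖ ≤ ‖X‖ * traceNorm T := by
  by_cases h : Summable fun k => ⟪e k, (T * X) (e k)⟫_ℂ
  · exact le_of_tendsto h.hasSum.norm (Eventually.of_forall fun s => norm_sum_inner_le hT X s)
  · rw [trace, tsum_eq_zero_of_not_summable h, norm_zero]
    simpa using norm_sum_inner_le hT X ∅

theorem Qt_apply_e {n : ℤ} {k : ℕ} (h : n < k) : Qt n (e k) = e k := by
  refine ell2_ext fun i => ?_
  rw [Qt_apply, e_apply]
  split_ifs <;> first | rfl | omega

theorem P_apply_e {n : ℤ} {k : ℕ} (h : (k : ℤ) ≤ n) : P n (e k) = e k := by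
  refine ell2_ext fun i => ?_
  rw [P_apply, e_apply]
  split_ifs <;> first | rfl | omega

/-- Elements of `S` annihilate the causal operators. -/
theorem inner_mul_apply_e_eq_zero {T Q : Op} (hT : T ∈ S) (hQ : Q ∈ Bc) (k : ℕ) :
    ⟪e k, (T * Q) (e k)⟫_ℂ = 0 := by
  have h1 : Q (e k) = Qt ((k : ℤ) - 1) (Q (e k)) := by
    refine ell2_ext fun i => ?_
    rw [Qt_apply]
    split_ifs with h
    · rw [← Qt_apply_e (show (i : ℤ) < k by omega)]
      exact mem_Bc_iff.1 hQ i (e k)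
    · rfl
  have h2 := congrArg (fun A : Op => (A (Q (e k)) : ℕ → ℂ) k) (hT.2 ((k : ℤ) - 1) (by omega))
  simp only [mul_apply_eq_comp, one_sub_Qt, sub_add_cancel] at h2
  rw [← h1, P_apply, if_pos le_rfl] at h2
  rw [inner_e_left, mul_apply_eq_comp, h2]
  rfl

theorem trace_mul_sub_eq {T B Q : Op} (hT : T ∈ S) (hQ : Q ∈ Bc) :
    trace (T * (B - Q)) = trace (T * B) := by
  refine tsum_congr fun k => ?_
  rw [mul_sub, sub_apply, inner_sub_right, inner_mul_apply_e_eq_zero hT hQ, sub_zero]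

theorem absOp_rankOne {u v : Ell2} (hu : ‖u‖ = 1) (hv : ‖v‖ = 1) :
    absOp (rankOne ℂ v u) = rankOne ℂ u u := by
  refine absOp_eq_of_isPositive (isPositive_rankOne_self u) ?_
  ext1 x
  simp [ContinuousLinearMap.star_eq_adjoint, inner_self_eq_norm_sq_to_K, hu, hv]

theorem hasSum_absOp_rankOne {u v : Ell2} (hu : ‖u‖ = 1) (hv : ‖v‖ = 1) :
    HasSum (fun k : ℕ => (⟪e k, absOp (rankOne ℂ v u) (e k)⟫_ℂ).re) 1 := by
  have h := hasSum_norm_coord_sq u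
  rw [hu, one_pow] at h
  refine h.congr_fun fun k => ?_
  rw [absOp_rankOne hu hv, rankOne_apply, inner_smul_right, inner_e_left, ← inner_conj_symm,
    inner_e_left, ← Complex.normSq_eq_conj_mul_self, Complex.ofReal_re, Complex.normSq_eq_norm_sq]

theorem rankOne_mem_S {u v : Ell2} (hu : ‖u‖ = 1) (hv : ‖v‖ = 1) {n : ℤ} (hPu : P n u = u)
    (hQv : Qt n v = v) : rankOne ℂ v u ∈ S := by
  refine ⟨(hasSum_absOp_rankOne hu hv).summable, fun m _ => ?_⟩
  rw [one_sub_Qt]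
  ext1 x
  simp only [mul_apply_eq_comp, rankOne_apply, map_smul, zero_apply]
  rcases lt_or_ge m n with h | h
  · have h1 : P (m + 1) v = 0 := ell2_ext fun k => by
      rw [← hQv, P_apply, Qt_apply, lp.coeFn_zero, Pi.zero_apply]
      split_ifs <;> first | rfl | omega
    rw [h1, smul_zero]
  · have h1 : Qt m u = 0 := ell2_ext fun k => by
      rw [← hPu, Qt_apply, P_apply, lp.coeFn_zero, Pi.zero_apply]
      split_ifs <;> first | rfl | omega
    rw [← ContinuousLinearMap.adjoint_inner_left, ← ContinuousLinearMap.star_eq_adjoint, star_Qt,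
      h1, inner_zero_left, zero_smul]

theorem trace_rankOne_mul (u v : Ell2) (B : Op) : trace (rankOne ℂ v u * B) = ⟪u, B v⟫_ℂ := by
  rw [← ContinuousLinearMap.adjoint_inner_left, lp.inner_eq_tsum, trace]
  refine tsum_congr fun k => ?_
  rw [mul_apply_eq_comp, rankOne_apply, inner_smul_right, inner_e_left,
    ← ContinuousLinearMap.adjoint_inner_left, ← inner_conj_symm, inner_e_left, mul_comm]
  rfl

/-- Corners of a compact operator attain their norm. -/
theorem exists_norm_inner_eq {B : Op} (hB : IsCompactOperator B) (n : ℕ) :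
    ∃ u v : Ell2, ‖u‖ = 1 ∧ ‖v‖ = 1 ∧ P n u = u ∧ Qt n v = v ∧
      ‖⟪u, B v⟫_ℂ‖ = ‖P n * B * Qt n‖ := by
  set A : Op := P n * B * Qt n with hA
  have hcorner : ∀ u v : Ell2, P n u = u → Qt n v = v → ⟪u, B v⟫_ℂ = ⟪u, A v⟫_ℂ := by
    intro u v hu hv
    rw [hA, mul_apply_eq_comp, mul_apply_eq_comp, hv,
      ← ContinuousLinearMap.adjoint_inner_left (P n), ← ContinuousLinearMap.star_eq_adjoint (P n),
      star_P, hu]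
  rcases (norm_nonneg A).eq_or_lt with h0 | hpos
  · refine ⟨e n, e (n + 1), norm_e _, norm_e _, P_apply_e le_rfl, Qt_apply_e (by omega), ?_⟩
    rw [hcorner _ _ (P_apply_e le_rfl) (Qt_apply_e (by omega)), norm_eq_zero.1 h0.symm]
    simp
  have hAc : IsCompactOperator A := (hB.clm_comp (P n)).comp_clm (Qt n)
  have hK : IsCompact (closure (A '' Metric.closedBall 0 1)) :=
    hAc.isCompact_closure_image_closedBall 1
  obtain ⟨z, hzK, hz⟩ := hK.exists_isMaxOn
    ⟨A 0, subset_closure ⟨0, Metric.mem_closedBall_self zero_le_one, rfl⟩⟩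
    continuous_norm.continuousOn
  have hKle : closure (A '' Metric.closedBall 0 1) ⊆ {w | ‖w‖ ≤ ‖A‖} := by
    refine closure_minimal ?_ (isClosed_le continuous_norm continuous_const)
    rintro _ ⟨x, hx, rfl⟩
    exact A.unit_le_opNorm x (mem_closedBall_zero_iff.1 hx)
  have hzA : ‖z‖ = ‖A‖ := by
    refine le_antisymm (hKle hzK) ?_
    refine ContinuousLinearMap.opNorm_le_of_unit_norm (𝕜 := ℂ) (norm_nonneg _) fun x hx => ?_
    exact hz (subset_closure ⟨x, mem_closedBall_zero_iff.2 hx.le, rfl⟩)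
  have hPz : P n z = z := by
    have : closure (A '' Metric.closedBall 0 1) ⊆ {w | P n w = w} := by
      refine closure_minimal ?_ (isClosed_eq (P n).continuous continuous_id)
      rintro _ ⟨x, -, rfl⟩
      rw [Set.mem_ofPred_eq, hA, mul_apply_eq_comp, mul_apply_eq_comp, P_apply_P, min_self]
    exact this hzK
  set y : Ell2 := ContinuousLinearMap.adjoint A z with hy
  have hQy : Qt n y = y := by
    rw [hy, ← ContinuousLinearMap.star_eq_adjoint, hA, star_mul, star_Qt, mul_apply_eq_comp,
      Qt_apply_Qt, max_self]
  have hzle : closure (A '' Metric.closedBall 0 1) ⊆ {w | ‖⟪z, w⟫_ℂ‖ ≤ ‖y‖} := by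
    refine closure_minimal ?_ (isClosed_le (by fun_prop) continuous_const)
    rintro _ ⟨x, hx, rfl⟩
    rw [Set.mem_ofPred_eq, ← ContinuousLinearMap.adjoint_inner_left]
    refine (norm_inner_le_norm _ _).trans ?_
    exact mul_le_of_le_one_right (norm_nonneg _) (mem_closedBall_zero_iff.1 hx)
  have hyA : ‖y‖ = ‖A‖ ^ 2 := by
    refine le_antisymm ?_ ?_
    · have h := (ContinuousLinearMap.adjoint A).le_opNorm z
      rwa [LinearIsometryEquiv.norm_map, hzA, ← sq] at h
    · have h := hzle hzK
      rw [Set.mem_ofPred_eq, inner_self_eq_norm_sq_to_K, hzA] at h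
      simpa using h
  have hPu : P n (((‖A‖⁻¹ : ℝ) : ℂ) • z) = ((‖A‖⁻¹ : ℝ) : ℂ) • z := by rw [map_smul, hPz]
  have hQv : Qt n ((((‖A‖ ^ 2)⁻¹ : ℝ) : ℂ) • y) = (((‖A‖ ^ 2)⁻¹ : ℝ) : ℂ) • y := by
    rw [map_smul, hQy]
  refine ⟨((‖A‖⁻¹ : ℝ) : ℂ) • z, (((‖A‖ ^ 2)⁻¹ : ℝ) : ℂ) • y, ?_, ?_, hPu, hQv, ?_⟩
  · rw [norm_smul, hzA, Complex.norm_real, norm_inv, norm_norm, inv_mul_cancel₀ hpos.ne']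
  · rw [norm_smul, hyA, Complex.norm_real, norm_inv, norm_pow, norm_norm,
      inv_mul_cancel₀ (by positivity)]
  · rw [hcorner _ _ hPu hQv, map_smul, inner_smul_left, inner_smul_right,
      ← ContinuousLinearMap.adjoint_inner_left, ← hy, inner_self_eq_norm_sq_to_K, hyA]
    generalize ‖A‖ = a at hpos ⊢
    rw [norm_mul, norm_mul, RCLike.norm_conj]
    simp only [norm_pow, Complex.coe_algebraMap, Complex.norm_real, norm_inv, Real.norm_eq_abs,
      abs_of_pos hpos, RCLike.ofReal_pow]
    field_simp

theorem norm_apply_of_star_mul_self_eq_one {E : Op} (hE : star E * E = 1) (x : Ell2) :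
    ‖E x‖ = ‖x‖ := by
  have h : ⟪E x, E x⟫_ℂ = ⟪x, x⟫_ℂ := by
    rw [← ContinuousLinearMap.adjoint_inner_right, ← ContinuousLinearMap.star_eq_adjoint,
      ← mul_apply_eq_comp, hE, one_apply_eq_self]
  rw [inner_self_eq_norm_sq_to_K, inner_self_eq_norm_sq_to_K] at h
  exact (sq_eq_sq₀ (norm_nonneg _) (norm_nonneg _)).1 (by exact_mod_cast h)

theorem norm_eq_one_of_star_mul_self_eq_one {E : Op} (hE : star E * E = 1) : ‖E‖ = 1 := by
  refine le_antisymm (ContinuousLinearMap.opNorm_le_bound _ zero_le_one fun x => ?_) ?_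
  · rw [one_mul, norm_apply_of_star_mul_self_eq_one hE]
  · have h := E.le_opNorm (e 0)
    rwa [norm_apply_of_star_mul_self_eq_one hE, norm_e, mul_one] at h

theorem zero_mem_Bc : (0 : Op) ∈ Bc := fun n _ => by simp

theorem one_mem_Bc : (1 : Op) ∈ Bc := fun n _ => by
  ext1 x
  simp only [mul_one, mul_apply_eq_comp, P_apply_P, min_self]

theorem mu_le {B Q : Op} (hQ : Q ∈ Bc) : mu B ≤ ‖B - Q‖ :=
  ciInf_le ⟨0, by rintro _ ⟨Q, rfl⟩; exact norm_nonneg _⟩ (⟨Q, hQ⟩ : Bc)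

theorem norm_corner_le_norm_sub {B Q : Op} (hQ : Q ∈ Bc) {n : ℤ} (hn : -1 ≤ n) :
    ‖P n * B * Qt n‖ ≤ ‖B - Q‖ := by
  have h : P n * B * Qt n = P n * (B - Q) * Qt n := by
    rw [mul_sub, sub_mul, P_mul_mul_Qt_eq_zero hQ hn, sub_zero]
  rw [h]
  exact norm_P_mul_mul_Qt_le n _

theorem norm_corner_le_mu (B : Op) {n : ℤ} (hn : -1 ≤ n) : ‖P n * B * Qt n‖ ≤ mu B := by
  have : Nonempty Bc := ⟨⟨0, zero_mem_Bc⟩⟩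
  exact le_ciInf fun Q => norm_corner_le_norm_sub Q.2 hn

theorem smul_mem_Bc {A : Op} (hA : A ∈ Bc) (c : ℂ) : c • A ∈ Bc := fun n hn => by
  rw [mul_smul_comm, smul_mul_assoc, hA n hn]

theorem exists_forall_le_of_tendsto_zero {c : ℕ → ℝ} (hc : ∀ n, 0 ≤ c n)
    (h0 : Tendsto c atTop (𝓝 0)) : ∃ N, ∀ n, c n ≤ c N := by
  by_cases hex : ∃ m, 0 < c m
  · obtain ⟨m, hm⟩ := hex
    refine Continuous.exists_forall_ge' continuous_of_discreteTopology m ?_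
    rw [cocompact_eq_cofinite, Nat.cofinite_eq_atTop]
    exact h0.eventually (ge_mem_nhds hm)
  · push Not at hex
    exact ⟨0, fun n => (hex n).trans (hc 0)⟩

/-- The largest corner of a compact operator is attained as a distance to the causal operators,
with a multiple of an isometry as the error. -/
theorem exists_causal_sub_eq_smul_isometry {B : Op} {m : ℝ}
    (hm : ∀ n : ℕ, ‖P n * B * Qt n‖ ≤ m) (hB : IsCompactOperator B) :
    ∃ Q ∈ Bc, ∃ E : Op, star E * E = 1 ∧ B - Q = (m : ℂ) • E := by
  rcases ((norm_nonneg _).trans (hm 0)).eq_or_lt with h0 | hpos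
  · refine ⟨B, mem_Bc_iff.2 fun i x => ?_, 1, by simp, by rw [← h0]; simp⟩
    have h1 : P i * B * Qt i = 0 := norm_le_zero_iff.1 ((hm i).trans h0.ge)
    have h2 := congrArg (fun A : Op => (A x : ℕ → ℂ) i) h1
    simp only [mul_apply_eq_comp] at h2
    rwa [P_apply, if_pos le_rfl] at h2
  · have hscale : ∀ n : ℕ, ‖P n * (((m⁻¹ : ℝ) : ℂ) • B) * Qt n‖ = m⁻¹ * ‖P n * B * Qt n‖ :=
      fun n => by
        rw [mul_smul_comm, smul_mul_assoc, norm_smul, Complex.norm_real, Real.norm_eq_abs,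
          abs_of_pos (inv_pos.2 hpos)]
    obtain ⟨E, hE, hEB⟩ := exists_isometry_sub_mem_Bc (B := ((m⁻¹ : ℝ) : ℂ) • B)
      (fun n => by rw [hscale, inv_mul_le_one₀ hpos]; exact hm n) (by
        simp only [hscale]
        simpa using (tendsto_norm_P_mul_mul_Qt hB).const_mul m⁻¹)
    refine ⟨_, smul_mem_Bc hEB (m : ℂ), E, hE, ?_⟩
    have hm' : (m : ℂ) ≠ 0 := by exact_mod_cast hpos.ne'
    rw [smul_sub, Complex.ofReal_inv, smul_inv_smul₀ hm', sub_sub_cancel]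

theorem muoo_nonneg (B : Op) : 0 ≤ muoo B := Real.iInf_nonneg fun _ => norm_nonneg _

theorem normalizedError_eq {B Q E : Op} {m : ℝ} (hm : 0 < m) (hE : star E * E = 1)
    (h : B - Q = (m : ℂ) • E) : normalizedError B Q = E := by
  have hm' : (m : ℂ) ≠ 0 := by exact_mod_cast hm.ne'
  rw [normalizedError, h, norm_smul, norm_eq_one_of_star_mul_self_eq_one hE, mul_one,
    Complex.norm_real, Real.norm_eq_abs, abs_of_pos hm, Complex.ofReal_inv, inv_smul_smul₀ hm']

theorem duality_and_allpass {B : Op} (hB : IsCompactOperator B) :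
    ∃ Qₒ ∈ Bc, ∃ Tₒ ∈ S, mu B = ‖B - Qₒ‖ ∧ traceNorm Tₒ = 1 ∧ mu B = ‖trace (Tₒ * B)‖ ∧
      IsGreatest {r : ℝ | ∃ T ∈ S, traceNorm T ≤ 1 ∧ r = ‖trace (T * B)‖} (mu B) ∧
      IsGreatest {r : ℝ | ∃ n : ℤ, -1 ≤ n ∧ r = ‖(1 - Qt n) * B * Qt n‖} (mu B) ∧
      (muoo B < mu B → IsPartialIsometry (normalizedError B Qₒ) ∧
        ∀ x ∈ Set.range Tₒ, ‖normalizedError B Qₒ x‖ = ‖x‖) := by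
  obtain ⟨N, hN⟩ := exists_forall_le_of_tendsto_zero
    (fun n => norm_nonneg (P n * B * Qt n)) (tendsto_norm_P_mul_mul_Qt hB)
  obtain ⟨Q, hQ, E, hE, hQE⟩ := exists_causal_sub_eq_smul_isometry hN hB
  have hnorm : ‖B - Q‖ = ‖P N * B * Qt N‖ := by
    rw [hQE, norm_smul, norm_eq_one_of_star_mul_self_eq_one hE, mul_one, Complex.norm_real,
      norm_norm]
  have hmu : mu B = ‖P N * B * Qt N‖ :=
    le_antisymm (hnorm ▸ mu_le hQ) (norm_corner_le_mu B (by omega))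
  obtain ⟨u, v, hu, hv, hPu, hQv, huv⟩ := exists_norm_inner_eq hB N
  have hS := rankOne_mem_S hu hv hPu hQv
  have htn : traceNorm (rankOne ℂ v u) = 1 := (hasSum_absOp_rankOne hu hv).tsum_eq
  have htr : mu B = ‖trace (rankOne ℂ v u * B)‖ := by rw [hmu, trace_rankOne_mul, huv]
  refine ⟨Q, hQ, rankOne ℂ v u, hS, hmu.trans hnorm.symm, htn, htr, ⟨⟨_, hS, htn.le, htr⟩, ?_⟩,
    ⟨⟨N, by omega, by rw [one_sub_Qt, hmu]⟩, ?_⟩, fun h => ?_⟩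
  · rintro _ ⟨T, hT, hT1, rfl⟩
    rw [← trace_mul_sub_eq hT hQ, hmu, ← hnorm]
    exact (norm_trace_mul_le hT.1 _).trans (mul_le_of_le_one_right (norm_nonneg _) hT1)
  · rintro _ ⟨n, hn, rfl⟩
    rw [one_sub_Qt]
    exact norm_corner_le_mu B hn
  · have hpos : 0 < ‖P N * B * Qt N‖ := hmu ▸ (muoo_nonneg B).trans_lt h
    rw [normalizedError_eq hpos hE hQE]
    exact ⟨fun x _ => norm_apply_of_star_mul_self_eq_one hE x,
      fun x _ => norm_apply_of_star_mul_self_eq_one hE x⟩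

theorem isOuter_one : IsOuter 1 := by
  refine ⟨one_mem_Bc, fun n _ => ?_, fun n _ x hx => subset_closure ⟨x, hx.1, rfl⟩⟩
  have h1 : LinearMap.range ((1 : Op) : Ell2 →ₗ[ℂ] Ell2) = ⊤ :=
    LinearMap.range_eq_top.2 fun x => ⟨x, rfl⟩
  have h2 : (LinearMap.range ((1 : Op) : Ell2 →ₗ[ℂ] Ell2)).topologicalClosure = ⊤ := by
    rw [h1]
    exact top_le_iff.1 (Submodule.le_topologicalClosure ⊤)
  have h3 : (LinearMap.range ((1 : Op) : Ell2 →ₗ[ℂ] Ell2)).topologicalClosure.starProjection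
      = 1 := by
    ext1 x
    exact Submodule.starProjection_eq_self_iff.2 (by rw [h2]; trivial)
  rw [h3]
  exact Commute.one_left _

theorem isInner_of_isometry {U : Op} (hU : U ∈ Bc) (h : star U * U = 1) : IsInner U :=
  ⟨hU, fun x _ => norm_apply_of_star_mul_self_eq_one h x, fun n _ => by
    rw [h]; exact Commute.one_left _⟩

theorem orthonormal_e : Orthonormal ℂ e := by
  refine ⟨norm_e, fun i j hij => ?_⟩
  change ⟪e i, e j⟫_ℂ = 0
  rw [inner_e_left, e_apply, if_neg hij]

/-- The unilateral shift. -/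
theorem exists_shift : ∃ R : Op, R ∈ Bc ∧ star R * R = 1 ∧ ∀ k, R (e k) = e (k + 1) := by
  have ho : Orthonormal ℂ fun k => e (k + 1) :=
    orthonormal_e.comp (fun k => k + 1) (add_left_injective 1)
  let V : Ell2 →ₗᵢ[ℂ] Ell2 := ho.orthogonalFamily.linearIsometry
  have hV : ∀ k, V (e k) = e (k + 1) := fun k => by
    rw [e, OrthogonalFamily.linearIsometry_apply_single]
    simp
  have hiso : star V.toContinuousLinearMap * V.toContinuousLinearMap = 1 :=
    star_mul_self_eq_one_of_norm_e (fun x => (V.norm_map x).le) fun i => by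
      rw [LinearIsometry.coe_toContinuousLinearMap, V.norm_map, norm_e]
  refine ⟨V.toContinuousLinearMap, mem_Bc_iff.2 fun i x => ?_, hiso, hV⟩
  rw [LinearIsometry.coe_toContinuousLinearMap, ← inner_e_left]
  rcases i with _ | i
  · have h := (ho.orthogonalFamily.hasSum_linearIsometry (Qt (0 : ℕ) x)).mapL (innerSL ℂ (e 0))
    refine h.unique (hasSum_zero.congr_fun fun k => ?_)
    rw [innerSL_apply_apply, LinearIsometry.toSpanSingleton_apply, inner_smul_right, inner_e_left,
      e_apply, if_neg (by omega), mul_zero]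
  · rw [← hV, V.inner_map_map, inner_e_left, Qt_apply, if_pos (by omega)]

/-- An operator that is bounded below by `1` along the basis has distance at least `1` to the
compact operators. -/
theorem one_le_muoo {B : Op} (hB : ∀ k : ℕ, 2 ≤ k → ‖B (e k)‖ = 1) : 1 ≤ muoo B := by
  have : Nonempty {Q : Op // IsCompactOperator Q} := ⟨⟨0, isCompactOperator_zero⟩⟩
  refine le_ciInf fun K => ?_
  have h0 := (tendsto_norm_mul_Qt K.2).const_add ‖B - K.1‖
  rw [add_zero] at h0
  refine ge_of_tendsto h0 ?_
  filter_upwards [eventually_ge_atTop 1] with n hn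
  have h1 := (B - K.1).le_opNorm (e (n + 1))
  have h2 := (K.1 * Qt n).le_opNorm (e (n + 1))
  have h3 := norm_sub_norm_le (B (e (n + 1))) (K.1 (e (n + 1)))
  rw [mul_apply_eq_comp, Qt_apply_e (by omega), norm_e, mul_one] at h2
  rw [norm_e, mul_one, sub_apply] at h1
  rw [hB _ (by omega)] at h3
  linarith

/-- The weighted backward shift with weights `1/2, 1, 1, …` shows that the condition
`muoo B < mu B` cannot be dropped. -/
theorem sharpness : ∃ T₁ T₂ T₃ T₂ᵢ T₂ₒ T₃ₒ T₃ᵢ : Op,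
    IsFactorizedData T₁ T₂ T₃ T₂ᵢ T₂ₒ T₃ₒ T₃ᵢ ∧ InvertibleInBc T₂ₒ ∧ InvertibleInBc T₃ₒ ∧
    star T₂ᵢ * T₂ᵢ = 1 ∧ T₃ᵢ * star T₃ᵢ = 1 ∧
    ¬ muoo (modelOp T₁ T₂ᵢ T₃ᵢ) < mu (modelOp T₁ T₂ᵢ T₃ᵢ) ∧ 0 < mu (modelOp T₁ T₂ᵢ T₃ᵢ) ∧
    ∃ Qₒ ∈ Bc, mu (modelOp T₁ T₂ᵢ T₃ᵢ) = ‖modelOp T₁ T₂ᵢ T₃ᵢ - Qₒ‖ ∧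
      ¬ IsPartialIsometry (normalizedError (modelOp T₁ T₂ᵢ T₃ᵢ) Qₒ) := by
  obtain ⟨R, hRc, hR, hRe⟩ := exists_shift
  have hRse : ∀ k, star R (e (k + 1)) = e k := fun k => by
    rw [← hRe, ← mul_apply_eq_comp, hR, one_apply_eq_self]
  set D : Op := 1 - (1 / 2 : ℂ) • rankOne ℂ (e 1) (e 1) with hD
  have hDapp : ∀ x, D x = x - ((1 / 2 : ℂ) * (x : ℕ → ℂ) 1) • e 1 := fun x => by
    rw [hD, sub_apply, smul_apply, rankOne_apply, inner_e_left, one_apply_eq_self, smul_smul]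
  have hDc : D ∈ Bc := mem_Bc_iff.2 fun i x => by
    rw [hDapp, coord_sub, coord_smul, e_apply, Qt_apply, if_pos le_rfl]
    rcases eq_or_ne i 1 with rfl | h
    · rw [Qt_apply, if_pos le_rfl]; simp
    · rw [if_neg h]; simp
  have hDn : ∀ x, ‖D x‖ ≤ ‖x‖ := fun x => by
    set c : ℂ := (x : ℕ → ℂ) 1 with hc
    have hy : ((x - c • e 1 : Ell2) : ℕ → ℂ) 1 = 0 := by
      rw [coord_sub, coord_smul, e_apply, if_pos rfl, mul_one, ← hc, sub_self]
    have h1 := norm_add_smul_e_sq _ 1 hy c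
    have h2 := norm_add_smul_e_sq _ 1 hy (1 / 2 * c)
    rw [sub_add_cancel] at h1
    rw [show x - c • e 1 + (1 / 2 * c) • e 1 = D x by rw [hDapp]; module, norm_mul] at h2
    refine (sq_le_sq₀ (norm_nonneg _) (norm_nonneg _)).1 ?_
    norm_num at h2
    nlinarith [sq_nonneg ‖c‖]
  have hinv : InvertibleInBc 1 := ⟨one_mem_Bc, 1, one_mem_Bc, mul_one 1, mul_one 1⟩
  have hmodel : modelOp D R 1 = star R * D := by rw [modelOp, star_one, mul_one]
  refine ⟨D, R, 1, R, 1, 1, 1, ⟨hDc, hRc, one_mem_Bc, isInner_of_isometry hRc hR, isOuter_one,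
    (mul_one R).symm, isInner_of_isometry one_mem_Bc (by simp), isOuter_one, (mul_one 1).symm⟩,
    hinv, hinv, hR, by simp, ?_⟩
  rw [hmodel]
  set B : Op := star R * D with hB
  have hBe : ∀ k : ℕ, B (e (k + 2)) = e (k + 1) := fun k => by
    rw [hB, mul_apply_eq_comp, hDapp, e_apply, if_neg (by omega), mul_zero, zero_smul, sub_zero,
      hRse]
  have hBe1 : B (e 1) = (1 / 2 : ℂ) • e 0 := by
    have h : e 1 - (1 / 2 : ℂ) • e 1 = (1 / 2 : ℂ) • e 1 := by module
    rw [hB, mul_apply_eq_comp, hDapp, e_apply, if_pos rfl, mul_one, h, map_smul, hRse]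
  have hBn : ‖B - 0‖ ≤ 1 := by
    rw [sub_zero]
    refine ContinuousLinearMap.opNorm_le_bound _ zero_le_one fun x => ?_
    have h1 : ‖star R‖ ≤ 1 := by
      rw [ContinuousLinearMap.star_eq_adjoint, LinearIsometryEquiv.norm_map,
        norm_eq_one_of_star_mul_self_eq_one hR]
    rw [hB, mul_apply_eq_comp]
    exact ((star R).le_of_opNorm_le h1 _).trans (by gcongr; exact hDn x)
  have hmu1 : 1 ≤ mu B := by
    refine le_trans ?_ (norm_corner_le_mu B (n := 1) (by norm_num))
    have h := (P 1 * B * Qt 1).le_opNorm (e 2)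
    rwa [mul_apply_eq_comp, mul_apply_eq_comp, Qt_apply_e (by norm_num), hBe 0,
      P_apply_e (by norm_num), norm_e, norm_e, mul_one] at h
  have hle : mu B ≤ ‖B - 0‖ := mu_le zero_mem_Bc
  have hnorm : ‖B - 0‖ = 1 := le_antisymm hBn (hmu1.trans hle)
  refine ⟨not_lt.2 ((hle.trans hBn).trans (one_le_muoo fun k hk => ?_)),
    zero_lt_one.trans_le hmu1, 0, zero_mem_Bc, le_antisymm hle (hBn.trans hmu1), fun hpi => ?_⟩
  · obtain ⟨k, rfl⟩ := Nat.exists_eq_add_of_le' hk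
    rw [hBe, norm_e]
  · have hE : normalizedError B 0 = B := by
      rw [normalizedError, hnorm, sub_zero, inv_one, Complex.ofReal_one, one_smul]
    rw [hE] at hpi
    have h := hpi (e 1) (by
      refine (Submodule.mem_orthogonal _ _).2 fun z hz => ?_
      have hz' : B z = 0 := hz
      have h1 : ⟪e 0, B z⟫_ℂ = 1 / 2 * (z : ℕ → ℂ) 1 := by
        rw [hB, mul_apply_eq_comp, ContinuousLinearMap.star_eq_adjoint,
          ContinuousLinearMap.adjoint_inner_right, hRe, inner_e_left, hDapp, coord_sub,
          coord_smul, e_apply, if_pos rfl]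
        ring
      rw [hz', inner_zero_right, zero_eq_mul] at h1
      rw [← inner_conj_symm, inner_e_left, h1.resolve_left (by norm_num), map_zero])
    rw [hBe1, norm_smul, norm_e, norm_e] at h
    norm_num at h

end LTV

end

theorem theorem2 :
    -- the duality and allpass statements, under (A1) and (A2)
    (∀ T₁ T₂ T₃ T₂ᵢ T₂ₒ T₃ₒ T₃ᵢ : LTV.Op,
      LTV.IsFactorizedData T₁ T₂ T₃ T₂ᵢ T₂ₒ T₃ₒ T₃ᵢ →
      LTV.InvertibleInBc T₂ₒ → LTV.InvertibleInBc T₃ₒ →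
      IsCompactOperator (LTV.modelOp T₁ T₂ᵢ T₃ᵢ) →
      ∃ Qₒ ∈ LTV.Bc, ∃ Tₒ ∈ LTV.S,
        -- i)
        LTV.mu (LTV.modelOp T₁ T₂ᵢ T₃ᵢ) = ‖LTV.modelOp T₁ T₂ᵢ T₃ᵢ - Qₒ‖ ∧
        LTV.traceNorm Tₒ = 1 ∧
        LTV.mu (LTV.modelOp T₁ T₂ᵢ T₃ᵢ) = ‖LTV.trace (Tₒ * LTV.modelOp T₁ T₂ᵢ T₃ᵢ)‖ ∧
        IsGreatest
          {r : ℝ | ∃ T ∈ LTV.S, LTV.traceNorm T ≤ 1 ∧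
            r = ‖LTV.trace (T * LTV.modelOp T₁ T₂ᵢ T₃ᵢ)‖}
          (LTV.mu (LTV.modelOp T₁ T₂ᵢ T₃ᵢ)) ∧
        IsGreatest
          {r : ℝ | ∃ n : ℤ, -1 ≤ n ∧
            r = ‖(1 - LTV.Qt n) * LTV.modelOp T₁ T₂ᵢ T₃ᵢ * LTV.Qt n‖}
          (LTV.mu (LTV.modelOp T₁ T₂ᵢ T₃ᵢ)) ∧
        -- ii)
        (LTV.muoo (LTV.modelOp T₁ T₂ᵢ T₃ᵢ) < LTV.mu (LTV.modelOp T₁ T₂ᵢ T₃ᵢ) →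
          LTV.IsPartialIsometry (LTV.normalizedError (LTV.modelOp T₁ T₂ᵢ T₃ᵢ) Qₒ) ∧
          ∀ x ∈ Set.range Tₒ,
            ‖LTV.normalizedError (LTV.modelOp T₁ T₂ᵢ T₃ᵢ) Qₒ x‖ = ‖x‖)) ∧
    -- sharpness of the condition `μ > μ_oo` among problems that satisfy (A1)
    (∃ T₁ T₂ T₃ T₂ᵢ T₂ₒ T₃ₒ T₃ᵢ : LTV.Op,
      LTV.IsFactorizedData T₁ T₂ T₃ T₂ᵢ T₂ₒ T₃ₒ T₃ᵢ ∧
      LTV.InvertibleInBc T₂ₒ ∧ LTV.InvertibleInBc T₃ₒ ∧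
      star T₂ᵢ * T₂ᵢ = 1 ∧ T₃ᵢ * star T₃ᵢ = 1 ∧
      ¬ LTV.muoo (LTV.modelOp T₁ T₂ᵢ T₃ᵢ) < LTV.mu (LTV.modelOp T₁ T₂ᵢ T₃ᵢ) ∧
      0 < LTV.mu (LTV.modelOp T₁ T₂ᵢ T₃ᵢ) ∧
      ∃ Qₒ ∈ LTV.Bc,
        LTV.mu (LTV.modelOp T₁ T₂ᵢ T₃ᵢ) = ‖LTV.modelOp T₁ T₂ᵢ T₃ᵢ - Qₒ‖ ∧
        ¬ LTV.IsPartialIsometry (LTV.normalizedError (LTV.modelOp T₁ T₂ᵢ T₃ᵢ) Qₒ)) := by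
  refine ⟨fun T₁ _ _ T₂ᵢ _ _ T₃ᵢ _ _ _ hB => ?_, LTV.sharpness⟩
  exact LTV.duality_and_allpass hB
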